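/- Let $k,\ell\ge 2$ be integers, let $c>0$ be real, and let $(m_n)_{n\ge1}$ be non-negative integers with $m_n/n\to c$ (for instance $m_n=\lfloor cn\rfloor$, or $m_n = cn$ when this is an integer). **The graphs $G_n=G_{n,m_n}^{k,\ell}$.** Choose $s_{i,j}\in\mathbb Z_n$ ($1\le i\le m_n$, $1\le j\le k$) independently and uniformly at random. $G_n$ is the random bipartite (multi)graph with vertex set $A_C\sqcup A_R\sqcup B$, where $A_C=\{c_i : i\in\mathbb Z_n\}$, $A_R=\{e_1,\dots,e_{m_n}\}$ and $B=\mathbb Z_n$. It is the incidence graph of the multisets $c_i=\{i,i+1\}$ and $e_i=\{s_{i,1},\dots,s_{i,k}\}$: the number of edges between $a\in A_C\cup A_R$ and $b\in B$ is the multiplicity of $b$ in $a$, and there are no other edges. Vertices in $A_C,A_R,B$ have weight $\ell-1$, $1$, $\ell$, respectively. $G_n(\circ)$ is $G_n$ rooted at a vertex chosen uniformly at random from all its vertices, independently of the $s_{i,j}$. **The tree $T=T_c^{k,\ell}$.** $T$ is the random rooted tree with vertices of types $A_C,A_R,B$ (of weights $\ell-1,1,\ell$, respectively), generated by independent random choices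 as follows. The root has type $A_C$, $A_R$, $B$ with probability $\frac1{2+c},\frac c{2+c},\frac1{2+c}$, respectively. A vertex of type $A_C$ has two children of type $B$ if it is the root, and one otherwise. A vertex of type $A_R$ has $k$ children of type $B$ if it is the root, and $k-1$ otherwise. A vertex of type $B$ has a $\mathrm{Poisson}(kc)$ number of children of type $A_R$ and, in addition, one child of type $A_C$ if its parent is of type $A_C$, and two children of type $A_C$ otherwise (that is, if it is the root or its parent is of type $A_R$). For a rooted graph $R$ and $d\in\mathbb N_0$, let $R|_d$ be the rooted subgraph induced by the vertices at distance at most $d$ from the root. Regard two rooted graphs as equal if there is a root-preserving isomorphism between them. **Claim.** $G_n$ converges locally weakly to $T$: for every $d\in\mathbb N_0$ and every rooted graph $H$, $$\lim_{n\to\infty}\Pr\big[G_n(\circ)|_d=H\big]=\Pr\big[T|_d=H\big].$$ This holds whichever of the edge multiplicities, the vertex types and the vertex weights the isomorphisms are required to preserve in addition to the root and adjacency (any subset of the three, including none; $H$ carries the corresponding data). -/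

import Mathlib

open Filter Topology MeasureTheory ProbabilityTheory
open scoped NNReal

namespace CuckooWindows

/-- The three kinds of vertices: helper edges `A_C`, ordinary edges `A_R`, and
table positions `B`. -/
inductive VType
  | helper
  | ordinary
  | table

/-- The vertex weights: `ℓ - 1` on `A_C`, `1` on `A_R`, `ℓ` on `B`. -/
def weightOf (ℓ : ℕ) : VType → ℕ
  | .helper => ℓ - 1
  | .ordinary => 1
  | .table => ℓ

/-- Rooted loopless multigraphs whose vertices carry a type and a weight.
`mult u v` is the number of parallel edges between `u` and `v`. -/
structure RootedGraph where
  V : Type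
  root : V
  mult : V → V → ℕ
  mult_symm : ∀ u v, mult u v = mult v u
  mult_self : ∀ v, mult v v = 0
  vtype : V → VType
  weight : V → ℕ

namespace RootedGraph

/-- The underlying simple graph. -/
def toSimpleGraph (R : RootedGraph) : SimpleGraph R.V where
  Adj u v := R.mult u v ≠ 0
  symm := ⟨fun u v h => by rw [R.mult_symm]; exact h⟩
  loopless := ⟨fun v h => h (R.mult_self v)⟩

/-- The rooted graph `R|_d`, induced by the vertices at distance at most `d` from the root.
The distance is `ℕ∞`-valued, with value `⊤` for vertices not connected to the root. -/
def ball (R : RootedGraph) (d : ℕ) : RootedGraph where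
  V := {v : R.V // R.toSimpleGraph.edist R.root v ≤ d}
  root := ⟨R.root, by simp⟩
  mult u v := R.mult u v
  mult_symm u v := R.mult_symm u v
  mult_self v := R.mult_self v
  vtype v := R.vtype v
  weight v := R.weight v

/-- Equality of rooted graphs up to isomorphism. An isomorphism always preserves the root and
adjacency; the flags say which further data it is required to preserve:
edge multiplicities, vertex types, vertex weights. -/
def Isom (keepMult keepType keepWeight : Prop) (R S : RootedGraph) : Prop :=
  ∃ f : R.V ≃ S.V, f R.root = S.root ∧
    (∀ u v, R.toSimpleGraph.Adj u v ↔ S.toSimpleGraph.Adj (f u) (f v)) ∧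
    (keepMult → ∀ u v, R.mult u v = S.mult (f u) (f v)) ∧
    (keepType → ∀ v, R.vtype v = S.vtype (f v)) ∧
    (keepWeight → ∀ v, R.weight v = S.weight (f v))

end RootedGraph

/-! ### The finite random graphs -/

/-- The vertex set `(A_C ∪ A_R) ∪ B`: the helper edges `c_i` (`i ∈ ℤ_n`), the ordinary edges
`e_1, …, e_m`, and the table positions `ℤ_n`. -/
abbrev GVertex (n m : ℕ) : Type := (ZMod n ⊕ Fin m) ⊕ ZMod n

/-- The type of a vertex. -/
def gType {n m : ℕ} : GVertex n m → VType
  | .inl (.inl _) => .helper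
  | .inl (.inr _) => .ordinary
  | .inr _ => .table

/-- The multiplicity of the table position `b` in a hyperedge: the helper edge `c_i` is the
multiset `{i, i + 1}` and the ordinary edge `e_i` is the multiset `{s i 1, …, s i k}`. -/
def incidence {n m k : ℕ} (s : Fin m → Fin k → ZMod n) : ZMod n ⊕ Fin m → ZMod n → ℕ
  | .inl i, b => (if b = i then 1 else 0) + (if b = i + 1 then 1 else 0)
  | .inr e, b => (Finset.univ.filter fun j => s e j = b).card

/-- The weighted incidence graph given by an outcome `s` of the choices of the ordinary edges,
rooted at the vertex `r`. -/
def incidenceGraph {n m k : ℕ} (ℓ : ℕ) (s : Fin m → Fin k → ZMod n) (r : GVertex n m) :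
    RootedGraph where
  V := GVertex n m
  root := r
  mult u v := match u, v with
    | .inl a, .inr b => incidence s a b
    | .inr b, .inl a => incidence s a b
    | _, _ => 0
  mult_symm u v := by rcases u with u | u <;> rcases v with v | v <;> rfl
  mult_self v := by rcases v with v | v <;> rfl
  vtype := gType
  weight v := weightOf ℓ (gType v)

/-- The probability of an event `P` for the random rooted graph `G_{n,m}^{k,ℓ}(∘)`: the `m * k`
elements of the ordinary edges are chosen independently and uniformly from `ℤ_n`, and the root
independently and uniformly from the vertices, i.e. all pairs `(s, r)` are equally likely. -/
noncomputable def graphProb (n m k ℓ : ℕ) (P : RootedGraph → Prop) : ℝ :=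
  (Nat.card {ω : (Fin m → Fin k → ZMod n) × GVertex n m // P (incidenceGraph ℓ ω.1 ω.2)} : ℝ) /
    (Nat.card ((Fin m → Fin k → ZMod n) × GVertex n m) : ℝ)

/-! ### The limiting random tree -/

/-- The list of types of the children of a vertex of type `t`, where `p` is the type of its parent
(`none` for the root) and `x` is the number of children of type `A_R` in case `t = B`. -/
def childTypes (k x : ℕ) (p : Option VType) (t : VType) : List VType :=
  match t, p with
  | .helper, none => List.replicate 2 .table
  | .helper, some _ => List.replicate 1 .table
  | .ordinary, none => List.replicate k .table
  | .ordinary, some _ => List.replicate (k - 1) .table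
  | .table, some .helper => List.replicate 1 .helper ++ List.replicate x .ordinary
  | .table, _ => List.replicate 2 .helper ++ List.replicate x .ordinary

/-- Vertices of the tree are addressed by lists: `[]` is the root and `i :: u` is the `i`-th child
of `u` (counting from `0`). For root type `t` and offspring numbers `X`, `nodeInfo k t X u` is
`none` if the tree has no vertex with address `u`, and otherwise it is the pair of the type of the
parent (`none` for the root) and the type of the vertex. -/
def nodeInfo (k : ℕ) (t : VType) (X : List ℕ → ℕ) : List ℕ → Option (Option VType × VType)
  | [] => some (none, t)
  | i :: u => (nodeInfo k t X u).bind fun q =>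
      ((childTypes k (X u) q.1 q.2)[i]?).map fun s => (some q.2, s)

/-- `u` is the address of the parent of `v`. -/
def IsParent (u v : List ℕ) : Prop := ∃ i, v = i :: u

open Classical in
/-- The weighted rooted tree with root type `t` and offspring numbers `X`. -/
noncomputable def tree (k ℓ : ℕ) (t : VType) (X : List ℕ → ℕ) : RootedGraph where
  V := {u : List ℕ // (nodeInfo k t X u).isSome}
  root := ⟨[], rfl⟩
  mult u v := if IsParent u.1 v.1 ∨ IsParent v.1 u.1 then 1 else 0
  mult_symm u v := by simp only [or_comm]
  mult_self v := by simp [IsParent]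
  vtype v := ((nodeInfo k t X v.1).get v.2).2
  weight v := weightOf ℓ ((nodeInfo k t X v.1).get v.2).2

instance : MeasurableSpace VType := ⊤

/-- The law of the type of the root. -/
noncomputable def rootLaw (c : ℝ≥0) : Measure VType :=
  (1 / (2 + c)) • Measure.dirac .helper + (c / (2 + c)) • Measure.dirac .ordinary +
    (1 / (2 + c)) • Measure.dirac .table

/-- The law of the random decisions behind the tree `T_c^{k,ℓ}`: the type of the root and,
independently, a family of independent Poisson variables with parameter `k c`, indexed by all
possible addresses. -/
noncomputable def treeLaw (k : ℕ) (c : ℝ≥0) : Measure (VType × (List ℕ → ℕ)) :=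
  (rootLaw c).prod (Measure.infinitePi fun _ : List ℕ => poissonMeasure (k * c))

/-- The probability of an event `P` for the random rooted tree `T_c^{k,ℓ}`. -/
noncomputable def treeProb (k ℓ : ℕ) (c : ℝ≥0) (P : RootedGraph → Prop) : ℝ :=
  (treeLaw k c).real {ω | P (tree k ℓ ω.1 ω.2)}

end CuckooWindows

/-! Unfold the graph from its root along non-backtracking walks, always listing helper edges before
ordinary ones. By `nodeInfo_offspring` the addresses and types of the unfolding are those of the
tree whose offspring numbers are read off the graph. If distinct addresses of length at most `L`,
with `d + 1 ≤ L`, lead to distinct vertices, then the ball of radius `d` is a copy of the ball of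
that tree (`isom_ball_of_walkInjective`). For the limit tree, the ball depends only on the root type
and on finitely many offspring numbers, collected in `trunc`. Hence the truncated data take
countably many values `y`, and the probability of each value is a root probability times a product
of Poisson weights (`treeLaw_real_truncEvent`).

Only lower bounds are needed. In `G_n` let the event for `y` say that the unfolding has no
collisions and truncates to `y`. These events are disjoint for different `y`, and each determines
the ball. If the lower limit of each probability is at least the tree probability of `y`, then,
because the tree probabilities sum to 1, no mass can be lost. Applying this to the set of `y` whose
ball is `H` and to its complement gives convergence (`tendsto_of_partition`). In particular,
collisions never have to be estimated from above.

The lower bound (`le_card_matches`) comes from counting outcomes. The tree splits into clusters,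
which are paths of tables and helper edges and become intervals of `ℤ_n` in the graph. An outcome
realizing `y` can be built by choosing far-apart positions `Q` for the cluster heads, names `E` for
the ordinary edges of the tree, increasing among siblings, and the slot `W` of the parent in each
non-root ordinary edge. All remaining ordinary edges must avoid the tables at depth less than `L`.
`walk_embed` shows that the unfolding is then as prescribed, and `placement_unique` that the outcome
and its root determine the placement. With arity `k + 1`, `o` ordinary vertices, of which `r` are
not the root, and `b` tables at depth less than `L`, there are `1 + k * o` heads (`card_heads`). The
powers of `n` therefore cancel, leaving `c ^ o * (k + 1) ^ r * exp (-b (k + 1) c) / (∏ X v !) / (2 +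
c)`, which is exactly the tree probability (`treeLaw_real_truncEvent_eq`). -/

namespace CuckooWindows

/-! ### Unfolding the incidence graph -/

section Unfolding

variable {n m k : ℕ}

/-- The element of `ℤ_n` behind a helper edge or a table position. -/
def coord : GVertex n m → ZMod n
  | .inl (.inl i) => i
  | .inl (.inr _) => 0
  | .inr b => b

open Classical in
/-- A slot of the ordinary edge `e` in which `b` occurs. -/
noncomputable def parentSlot (s : Fin m → Fin (k + 1) → ZMod n) (e : Fin m) (b : ZMod n) :
    Fin (k + 1) :=
  if h : ∃ j, s e j = b then h.choose else 0

/-- The ordinary edges through `b` other than the parent. -/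
def ordinaryChildren (s : Fin m → Fin (k + 1) → ZMod n) (p : Option (GVertex n m))
    (b : ZMod n) : Finset (Fin m) :=
  Finset.univ.filter fun e => (∃ j, s e j = b) ∧ p ≠ some (.inl (.inr e))

/-- The helper edges through `b` other than the parent. -/
def helperChildren (p : Option (GVertex n m)) (b : ZMod n) : List (GVertex n m) :=
  match p with
  -- The two helper edges through `b` have indices `b` and `b - 1`, with sum `2 * b - 1`;
  -- subtracting the parent leaves the other one. The formula `2 * i + 1 - coord p` in `children`
  -- comes from the same reasoning for the tables `i` and `i + 1`.
  | some (.inl (.inl h)) => [.inl (.inl (2 * b - 1 - h))]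
  | _ => [.inl (.inl b), .inl (.inl (b - 1))]

/-- The ordered list of the neighbours of a vertex other than its parent. -/
noncomputable def children (s : Fin m → Fin (k + 1) → ZMod n) :
    Option (GVertex n m) → GVertex n m → List (GVertex n m)
  | none, .inl (.inl i) => [.inr i, .inr (i + 1)]
  | some p, .inl (.inl i) => [.inr (2 * i + 1 - coord p)]
  | none, .inl (.inr e) => List.ofFn fun j => .inr (s e j)
  | some p, .inl (.inr e) =>
      List.ofFn fun i : Fin k => .inr (s e ((parentSlot s e (coord p)).succAbove i))
  | p, .inr b => helperChildren p b ++
      ((ordinaryChildren s p b).sort (· ≤ ·)).map fun e => .inl (.inr e)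

/-- The non-backtracking walk from `r` with a given address, as the pair of its last two
vertices. -/
noncomputable def walk (s : Fin m → Fin (k + 1) → ZMod n) (r : GVertex n m) :
    List ℕ → Option (Option (GVertex n m) × GVertex n m)
  | [] => some (none, r)
  | i :: u => (walk s r u).bind fun q => ((children s q.1 q.2)[i]?).map fun v => (some q.2, v)

/-- The number of ordinary edges continuing the walk with a given address. -/
noncomputable def offspring (s : Fin m → Fin (k + 1) → ZMod n) (r : GVertex n m)
    (u : List ℕ) : ℕ :=
  match walk s r u with
  | some (p, .inr b) => (ordinaryChildren s p b).card
  | _ => 0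

theorem map_gType_children (s : Fin m → Fin (k + 1) → ZMod n) (p : Option (GVertex n m))
    (v : GVertex n m) (x : ℕ) (hx : ∀ b, v = .inr b → x = (ordinaryChildren s p b).card) :
    (children s p v).map gType = childTypes (k + 1) x (p.map gType) (gType v) := by
  rcases v with (i | e) | b
  · rcases p with _ | p <;> simp [children, childTypes, gType]
  · rcases p with _ | p
    · simp only [children, childTypes, gType, List.map_ofFn, Option.map_none]
      exact List.ofFn_const _ _
    · simp only [children, childTypes, gType, List.map_ofFn, Option.map_some]
      exact List.ofFn_const _ _
  · rw [hx b rfl]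
    have h : (List.map gType (((ordinaryChildren s p b).sort (· ≤ ·)).map
        fun e => (Sum.inl (Sum.inr e) : GVertex n m))) =
        List.replicate (ordinaryChildren s p b).card .ordinary := by
      rw [List.map_map, List.eq_replicate_iff]
      simp [gType]
    rcases p with _ | ((p | p) | p) <;>
      simp [children, childTypes, helperChildren, gType] <;> simpa [gType] using h

/-- This makes graph and tree comparable: each step of the recursion for walks is, on types, a step
of the recursion for the tree, by `map_gType_children`. -/
theorem nodeInfo_offspring (s : Fin m → Fin (k + 1) → ZMod n) (r : GVertex n m) (u : List ℕ) :
    nodeInfo (k + 1) (gType r) (offspring s r) u =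
      (walk s r u).map fun q => (q.1.map gType, gType q.2) := by
  induction u with
  | nil => rfl
  | cons i u ih =>
    rw [nodeInfo, walk, ih]
    rcases hw : walk s r u with _ | ⟨p, v⟩
    · rfl
    · simp only [Option.map_some, Option.bind_some]
      rw [← map_gType_children s p v (offspring s r u)]
      · rw [List.getElem?_map]
        cases (children s p v)[i]? <;> rfl
      · rintro b rfl
        rw [offspring, hw]

variable (ℓ : ℕ) (s : Fin m → Fin (k + 1) → ZMod n) (r : GVertex n m)

theorem incidence_ordinary_ne_zero {e : Fin m} {b : ZMod n} :
    incidence s (.inr e) b ≠ 0 ↔ ∃ j, s e j = b := by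
  simp [incidence, Finset.filter_eq_empty_iff]

theorem incidence_helper_ne_zero {i : ZMod n} {b : ZMod n} :
    incidence s (.inl i) b ≠ 0 ↔ b = i ∨ b = i + 1 := by
  simp only [incidence]
  split_ifs <;> simp_all

theorem parentSlot_spec {e : Fin m} {b : ZMod n} (h : ∃ j, s e j = b) :
    s e (parentSlot s e b) = b := by
  rw [parentSlot, dif_pos h]
  exact h.choose_spec

theorem adj_of_mem_children {p : Option (GVertex n m)} {v w : GVertex n m}
    (hp : ∀ a, p = some a → (incidenceGraph ℓ s r).mult v a ≠ 0) (hw : w ∈ children s p v) :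
    (incidenceGraph ℓ s r).mult v w ≠ 0 := by
  rcases v with (i | e) | b
  · rcases p with _ | ((a | a) | a)
    · simp only [children, List.mem_cons, List.not_mem_nil, or_false] at hw
      rcases hw with rfl | rfl <;> exact (incidence_helper_ne_zero s).2 (by simp)
    · exact absurd rfl (hp _ rfl)
    · exact absurd rfl (hp _ rfl)
    · have := (incidence_helper_ne_zero s).1 (hp _ rfl)
      simp only [children, List.mem_cons, List.not_mem_nil, or_false, coord] at hw
      subst hw
      refine (incidence_helper_ne_zero s).2 ?_
      rcases this with rfl | rfl
      · right; ring
      · left; ring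
  · rcases p with _ | a
    · simp only [children, List.mem_ofFn] at hw
      obtain ⟨j, rfl⟩ := hw
      exact (incidence_ordinary_ne_zero s).2 ⟨_, rfl⟩
    · simp only [children, List.mem_ofFn] at hw
      obtain ⟨j, rfl⟩ := hw
      exact (incidence_ordinary_ne_zero s).2 ⟨_, rfl⟩
  · have : w ∈ helperChildren p b ∨ ∃ e ∈ ordinaryChildren s p b, .inl (.inr e) = w := by
      simpa [children] using hw
    rcases this with hw | ⟨e, he, rfl⟩
    · rcases p with _ | ((a | a) | a)
      · simp only [helperChildren, List.mem_cons, List.not_mem_nil, or_false] at hw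
        rcases hw with rfl | rfl <;> exact (incidence_helper_ne_zero s).2 (by simp)
      · have := (incidence_helper_ne_zero s).1 (hp _ rfl)
        simp only [helperChildren, List.mem_cons, List.not_mem_nil, or_false] at hw
        subst hw
        refine (incidence_helper_ne_zero s).2 ?_
        rcases this with rfl | rfl
        · right; ring
        · left; ring
      · simp only [helperChildren, List.mem_cons, List.not_mem_nil, or_false] at hw
        rcases hw with rfl | rfl <;> exact (incidence_helper_ne_zero s).2 (by simp)
      · exact absurd rfl (hp _ rfl)
    · simp only [ordinaryChildren, Finset.mem_filter] at he
      exact (incidence_ordinary_ne_zero s).2 he.2.1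

/-- Together with `adj_of_mem_children` this shows that parent and children exhaust the
neighbourhood, so the unfolding reaches everything connected to the root. -/
theorem mem_children_of_adj {p : Option (GVertex n m)} {v w : GVertex n m}
    (hp : ∀ a, p = some a → (incidenceGraph ℓ s r).mult v a ≠ 0)
    (h : (incidenceGraph ℓ s r).mult v w ≠ 0) : w ∈ children s p v ∨ p = some w := by
  rcases v with (i | e) | b
  · rcases w with w | w
    · exact absurd rfl h
    have hw := (incidence_helper_ne_zero s).1 h
    rcases p with _ | ((a | a) | a)
    · left
      simpa [children] using hw
    · exact absurd rfl (hp _ rfl)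
    · exact absurd rfl (hp _ rfl)
    · have := (incidence_helper_ne_zero s).1 (hp _ rfl)
      simp only [children, List.mem_cons, List.not_mem_nil, or_false, coord, Sum.inr.injEq,
        Option.some.injEq]
      rcases this with rfl | rfl <;> rcases hw with rfl | rfl
      · right; rfl
      · left; ring
      · left; ring
      · right; rfl
  · rcases w with w | w
    · exact absurd rfl h
    obtain ⟨j, rfl⟩ := (incidence_ordinary_ne_zero s).1 h
    rcases p with _ | ((a | a) | a)
    · exact .inl (List.mem_ofFn.2 ⟨j, rfl⟩)
    · exact absurd rfl (hp _ rfl)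
    · exact absurd rfl (hp _ rfl)
    · have := (incidence_ordinary_ne_zero s).1 (hp _ rfl)
      by_cases hj : j = parentSlot s e a
      · right
        rw [hj, parentSlot_spec s this]
      · left
        obtain ⟨i, hi⟩ := Fin.exists_succAbove_eq hj
        simp only [children, List.mem_ofFn, coord]
        exact ⟨i, by rw [hi]⟩
  · rcases w with (w | w) | w
    · have hw := (incidence_helper_ne_zero s).1 h
      have key : Sum.inl (Sum.inl w) ∈ helperChildren p b ∨ p = some (Sum.inl (Sum.inl w)) := by
        have h0 : Sum.inl (Sum.inl w) ∈
            ([.inl (.inl b), .inl (.inl (b - 1))] : List (GVertex n m)) := by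
          rcases hw with rfl | rfl <;> simp
        rcases p with _ | ((a | a) | a)
        · exact .inl h0
        · have := (incidence_helper_ne_zero s).1 (hp _ rfl)
          simp only [helperChildren, List.mem_cons, List.not_mem_nil, or_false, Sum.inl.injEq,
            Option.some.injEq]
          rcases this with rfl | h1 <;> rcases hw with rfl | h2
          · right; rfl
          · left; rw [h2]; ring
          · left; rw [h1]; ring
          · right; exact add_right_cancel (h1.symm.trans h2)
        · exact .inl h0
        · exact .inl h0
      rcases key with key | key
      · left; simp [children, key]
      · exact .inr key
    · have hw := (incidence_ordinary_ne_zero s).1 h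
      by_cases hpw : p = some (.inl (.inr w))
      · exact .inr hpw
      · left
        simp only [children, List.mem_append, List.mem_map, Finset.mem_sort]
        exact .inr ⟨w, by simp [ordinaryChildren, hw, hpw], rfl⟩
    · exact absurd rfl h

theorem walk_cons {i : ℕ} {u : List ℕ} {q : Option (GVertex n m) × GVertex n m} :
    walk s r (i :: u) = some q ↔ ∃ p, ∃ v, walk s r u = some (p, v) ∧ q.1 = some v ∧
      (children s p v)[i]? = some q.2 := by
  rw [walk]
  rcases q with ⟨a, b⟩
  cases walk s r u with
  | none => simp
  | some q =>
    rcases q with ⟨p, v⟩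
    simp only [Option.bind_some, Option.map_eq_some_iff, Prod.mk.injEq, Option.some.injEq]
    grind

theorem walk_adj {u : List ℕ} {q : Option (GVertex n m) × GVertex n m}
    (h : walk s r u = some q) : ∀ a, q.1 = some a → (incidenceGraph ℓ s r).mult q.2 a ≠ 0 := by
  induction u generalizing q with
  | nil =>
    simp only [walk, Option.some.injEq] at h
    subst h
    simp
  | cons i u ih =>
    obtain ⟨p, v, hu, h1, h2⟩ := (walk_cons s r).1 h
    intro a ha
    obtain rfl : v = a := by simpa [h1] using ha
    exact fun h0 => adj_of_mem_children ℓ s r (ih hu) (List.mem_of_getElem? h2)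
      (((incidenceGraph ℓ s r).mult_symm _ _).trans h0)

/-- The walk visits distinct vertices at the addresses of length at most `L`. -/
def WalkInjective (L : ℕ) : Prop :=
  ∀ u v p q, u.length ≤ L → v.length ≤ L → walk s r u = some p → walk s r v = some q →
    p.2 = q.2 → u = v

end Unfolding

/-! ### Isomorphisms of rooted graphs -/

namespace RootedGraph

theorem Isom.symm {a b c : Prop} {R S : RootedGraph} (h : Isom a b c R S) : Isom a b c S R := by
  obtain ⟨f, h0, h1, h2, h3, h4⟩ := h
  refine ⟨f.symm, by rw [← h0, f.symm_apply_apply], fun u v => ?_, fun ha u v => ?_,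
    fun hb v => ?_, fun hc v => ?_⟩
  · rw [h1, f.apply_symm_apply, f.apply_symm_apply]
  · rw [h2 ha, f.apply_symm_apply, f.apply_symm_apply]
  · rw [h3 hb, f.apply_symm_apply]
  · rw [h4 hc, f.apply_symm_apply]

theorem Isom.trans {a b c : Prop} {R S T : RootedGraph} (h : Isom a b c R S)
    (h' : Isom a b c S T) : Isom a b c R T := by
  obtain ⟨f, h0, h1, h2, h3, h4⟩ := h
  obtain ⟨g, g0, g1, g2, g3, g4⟩ := h'
  exact ⟨f.trans g, by simp [h0, g0], fun u v => (h1 u v).trans (g1 _ _),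
    fun ha u v => (h2 ha u v).trans (g2 ha _ _), fun hb v => (h3 hb v).trans (g3 hb _),
    fun hc v => (h4 hc v).trans (g4 hc _)⟩

theorem Isom.of_equiv (a b c : Prop) {R S : RootedGraph} (f : R.V ≃ S.V)
    (h0 : f R.root = S.root) (h1 : ∀ u v, R.mult u v = S.mult (f u) (f v))
    (h2 : ∀ v, R.vtype v = S.vtype (f v)) (h3 : ∀ v, R.weight v = S.weight (f v)) :
    Isom a b c R S :=
  ⟨f, h0, fun u v => by simp only [toSimpleGraph, h1], fun _ => h1, fun _ => h2, fun _ => h3⟩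

theorem Isom.congr_left {a b c : Prop} {R S : RootedGraph} (h : Isom a b c R S)
    (H : RootedGraph) : Isom a b c R H ↔ Isom a b c S H :=
  ⟨fun h' => h.symm.trans h', fun h' => h.trans h'⟩

end RootedGraph

/-! ### Distances in the tree -/

theorem le_add_length_of_walk {V : Type*} {G : SimpleGraph V} (f : V → ℕ)
    (hf : ∀ u v, G.Adj u v → f v ≤ f u + 1) {u v : V} (w : G.Walk u v) :
    f v ≤ f u + w.length := by
  induction w with
  | nil => simp
  | cons h w ih =>
    have := hf _ _ h
    rw [SimpleGraph.Walk.length_cons]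
    omega

section Tree

variable (k ℓ : ℕ) (t : VType) (X : List ℕ → ℕ)

theorem nodeInfo_cons {i : ℕ} {u : List ℕ} {q : Option VType × VType} :
    nodeInfo k t X (i :: u) = some q ↔ ∃ p a, nodeInfo k t X u = some (p, a) ∧ q.1 = some a ∧
      (childTypes k (X u) p a)[i]? = some q.2 := by
  rw [nodeInfo]
  rcases q with ⟨b, c⟩
  cases nodeInfo k t X u with
  | none => simp
  | some q =>
    rcases q with ⟨p, v⟩
    simp only [Option.bind_some, Option.map_eq_some_iff, Prod.mk.injEq, Option.some.injEq]
    grind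

theorem isSome_nodeInfo_of_cons {i : ℕ} {u : List ℕ} (h : (nodeInfo k t X (i :: u)).isSome) :
    (nodeInfo k t X u).isSome := by
  obtain ⟨q, hq⟩ := Option.isSome_iff_exists.1 h
  obtain ⟨p, a, h, -⟩ := (nodeInfo_cons k t X).1 hq
  simp [h]

theorem tree_adj {u v : (tree k ℓ t X).V} :
    (tree k ℓ t X).toSimpleGraph.Adj u v ↔ IsParent u.1 v.1 ∨ IsParent v.1 u.1 := by
  simp only [RootedGraph.toSimpleGraph, tree]
  split_ifs with h <;> simp [h]

theorem edist_root_le_length (u : List ℕ) (hu : (nodeInfo k t X u).isSome) :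
    (tree k ℓ t X).toSimpleGraph.edist (tree k ℓ t X).root ⟨u, hu⟩ ≤ u.length := by
  induction u with
  | nil => exact (SimpleGraph.edist_self (G := (tree k ℓ t X).toSimpleGraph)).le
  | cons i u ih =>
    have hu' := isSome_nodeInfo_of_cons k t X hu
    have hadj : (tree k ℓ t X).toSimpleGraph.Adj ⟨u, hu'⟩ ⟨i :: u, hu⟩ :=
      (tree_adj k ℓ t X).2 (.inl ⟨i, rfl⟩)
    refine (SimpleGraph.edist_triangle (v := ⟨u, hu'⟩)).trans ?_
    rw [SimpleGraph.edist_eq_one_iff_adj.2 hadj, List.length_cons, Nat.cast_add, Nat.cast_one]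
    gcongr
    exact ih hu'

/-- Adjacent addresses differ in length by one, so length is a 1-Lipschitz potential and bounds the
distance from below; the path of suffixes bounds it from above. -/
theorem edist_root_le_iff (u : (tree k ℓ t X).V) (d : ℕ) :
    (tree k ℓ t X).toSimpleGraph.edist (tree k ℓ t X).root u ≤ d ↔ u.1.length ≤ d := by
  constructor
  · intro h
    have hne : (tree k ℓ t X).toSimpleGraph.edist (tree k ℓ t X).root u ≠ ⊤ :=
      (h.trans_lt (ENat.natCast_lt_top d)).ne
    obtain ⟨w, hw⟩ := SimpleGraph.exists_walk_of_edist_ne_top hne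
    rw [← hw] at h
    have := le_add_length_of_walk (fun v : (tree k ℓ t X).V => v.1.length) (fun a b hab => by
      rcases (tree_adj k ℓ t X).1 hab with ⟨i, hi⟩ | ⟨i, hi⟩ <;> simp only [hi, List.length_cons]
      · exact le_rfl
      · omega) w
    have h0 : (tree k ℓ t X).root.1.length = 0 := rfl
    have h1 : w.length ≤ d := by exact_mod_cast h
    simp only [h0] at this
    omega
  · intro h
    exact (edist_root_le_length k ℓ t X u.1 u.2).trans (by exact_mod_cast h)

end Tree

/-! ### Balls without collisions are trees -/

section Ball

variable {n m k : ℕ} (ℓ : ℕ) (s : Fin m → Fin (k + 1) → ZMod n) (r : GVertex n m)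

theorem exists_walk_of_adj {u : List ℕ} {q : Option (GVertex n m) × GVertex n m}
    {w : GVertex n m} (hu : walk s r u = some q) (h : (incidenceGraph ℓ s r).mult q.2 w ≠ 0) :
    ∃ v p, walk s r v = some (p, w) ∧ (IsParent u v ∨ IsParent v u) := by
  rcases mem_children_of_adj ℓ s r (walk_adj ℓ s r hu) h with h' | h'
  · obtain ⟨i, hi⟩ := List.mem_iff_getElem?.1 h'
    exact ⟨i :: u, some q.2, (walk_cons s r).2 ⟨q.1, q.2, hu, rfl, hi⟩, .inl ⟨i, rfl⟩⟩
  · cases u with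
    | nil =>
      simp only [walk, Option.some.injEq] at hu
      subst hu
      simp at h'
    | cons i u =>
      obtain ⟨p, v, h1, h2, -⟩ := (walk_cons s r).1 hu
      obtain rfl : v = w := by simpa [h2] using h'
      exact ⟨u, p, h1, .inr ⟨i, rfl⟩⟩

/-- Path lifting: each step of a graph walk either continues the current address or shortens it, so
the address grows by at most one per step. -/
theorem exists_walk_of_graphWalk {a b : (incidenceGraph ℓ s r).V}
    (w : (incidenceGraph ℓ s r).toSimpleGraph.Walk a b) {u : List ℕ}
    {p : Option (GVertex n m)} (hu : walk s r u = some (p, a)) :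
    ∃ v q, walk s r v = some (q, b) ∧ v.length ≤ u.length + w.length := by
  induction w generalizing u p with
  | nil => exact ⟨u, p, hu, le_rfl⟩
  | cons h w ih =>
    obtain ⟨v, q, hv, hp⟩ := exists_walk_of_adj ℓ s r hu h
    obtain ⟨v', q', hv', hl⟩ := ih hv
    refine ⟨v', q', hv', ?_⟩
    rw [SimpleGraph.Walk.length_cons]
    rcases hp with ⟨i, rfl⟩ | ⟨i, rfl⟩ <;> simp only [List.length_cons] at * <;> omega

theorem edist_walk_le {u : List ℕ} {q : Option (GVertex n m) × GVertex n m}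
    (hu : walk s r u = some q) :
    (incidenceGraph ℓ s r).toSimpleGraph.edist (incidenceGraph ℓ s r).root q.2 ≤ u.length := by
  induction u generalizing q with
  | nil =>
    simp only [walk, Option.some.injEq] at hu
    subst hu
    exact (SimpleGraph.edist_self (G := (incidenceGraph ℓ s r).toSimpleGraph)).le
  | cons i u ih =>
    obtain ⟨p, v, h1, h2, h3⟩ := (walk_cons s r).1 hu
    have hadj : (incidenceGraph ℓ s r).toSimpleGraph.Adj v q.2 :=
      adj_of_mem_children ℓ s r (walk_adj ℓ s r h1) (List.mem_of_getElem? h3)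
    refine (SimpleGraph.edist_triangle (v := v)).trans ?_
    rw [List.length_cons, Nat.cast_add, Nat.cast_one]
    exact add_le_add (ih h1) (SimpleGraph.edist_eq_one_iff_adj.2 hadj).le

variable {s r} {L : ℕ}

theorem isParent_of_adj (hL : WalkInjective s r L) {u v : List ℕ}
    {p q : Option (GVertex n m) × GVertex n m} (hu : walk s r u = some p)
    (hv : walk s r v = some q) (hul : u.length + 1 ≤ L) (hvl : v.length ≤ L)
    (h : (incidenceGraph ℓ s r).mult p.2 q.2 ≠ 0) : IsParent u v ∨ IsParent v u := by
  obtain ⟨v', p', hv', hp⟩ := exists_walk_of_adj ℓ s r hu h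
  obtain rfl : v' = v := by
    refine hL _ _ _ _ ?_ hvl hv' hv rfl
    rcases hp with ⟨i, rfl⟩ | ⟨i, rfl⟩ <;> simp only [List.length_cons] at * <;> omega
  exact hp

/-- A repeated entry would be a collision between two children of the ordinary edge, or between a
child and the parent. The children lie one level deeper, hence the bound `u.length + 1 ≤ L`. -/
theorem slots_injective (hL : WalkInjective s r L) {u : List ℕ} {p : Option (GVertex n m)}
    {e : Fin m} (hu : walk s r u = some (p, .inl (.inr e))) (hul : u.length + 1 ≤ L) :
    Function.Injective (s e) := by
  have hchild : ∀ i b, (children s p (.inl (.inr e)))[i]? = some b →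
      walk s r (i :: u) = some (some (.inl (.inr e)), b) :=
    fun i b h => (walk_cons s r).2 ⟨_, _, hu, rfl, h⟩
  intro j j' hjj
  rcases p with _ | ((a | a) | a)
  · have h1 : ∀ j : Fin (k + 1), walk s r (j.1 :: u) = some (some (.inl (.inr e)), .inr (s e j)) :=
      fun j => hchild _ _ (by simp [children, -List.ofFn_succ]; omega)
    have := hL (j.1 :: u) (j'.1 :: u) _ _ hul hul (h1 j) (h1 j') (by simp [hjj])
    exact Fin.ext (by simpa using this)
  · exact absurd rfl (walk_adj 0 s r hu _ rfl)
  · exact absurd rfl (walk_adj 0 s r hu _ rfl)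
  · have hslot := parentSlot_spec s
      ((incidence_ordinary_ne_zero s).1 (walk_adj 0 s r hu _ rfl))
    have h1 : ∀ i : Fin k, walk s r (i.1 :: u) = some (some (.inl (.inr e)),
        .inr (s e ((parentSlot s e a).succAbove i))) :=
      fun i => hchild _ _ (by simp [children, coord])
    have h2 : ∀ i : Fin k, s e ((parentSlot s e a).succAbove i) ≠ a := by
      intro i hi
      cases u with
      | nil => simp [walk] at hu
      | cons i' u =>
        obtain ⟨p, v, h3, h4, -⟩ := (walk_cons s r).1 hu
        have h5 : Sum.inr a = v := by simpa using h4
        have := hL (i.1 :: i' :: u) u _ _ hul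
          (by simp only [List.length_cons] at hul; omega) (h1 i) h3 (by simp [← h5, hi])
        have := congrArg List.length this
        simp only [List.length_cons] at this
        omega
    rcases eq_or_ne j (parentSlot s e a) with hj | hj <;>
      rcases eq_or_ne j' (parentSlot s e a) with hj' | hj'
    · rw [hj, hj']
    · obtain ⟨i, rfl⟩ := Fin.exists_succAbove_eq hj'
      exact absurd (hjj.symm.trans (by rw [hj, hslot])) (h2 i)
    · obtain ⟨i, rfl⟩ := Fin.exists_succAbove_eq hj
      exact absurd (hjj.trans (by rw [hj', hslot])) (h2 i)
    · obtain ⟨i, rfl⟩ := Fin.exists_succAbove_eq hj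
      obtain ⟨i', rfl⟩ := Fin.exists_succAbove_eq hj'
      have := hL (i.1 :: u) (i'.1 :: u) _ _ hul hul (h1 i) (h1 i') (by simp [hjj])
      rw [Fin.ext (show i.1 = i'.1 by simpa using this)]

/-- Multiple edges at a helper edge are excluded because `i ≠ i + 1` for `n ≥ 2`, and at an ordinary
edge by `slots_injective`. -/
theorem mult_le_one (hn : 2 ≤ n) (hL : WalkInjective s r L) {u v : List ℕ}
    {p q : Option (GVertex n m) × GVertex n m} (hu : walk s r u = some p)
    (hv : walk s r v = some q) (hul : u.length + 1 ≤ L) (hvl : v.length + 1 ≤ L) :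
    (incidenceGraph ℓ s r).mult p.2 q.2 ≤ 1 := by
  have : Fact (1 < n) := ⟨hn⟩
  have hh : ∀ i b : ZMod n, incidence s (.inl i) b ≤ 1 := by
    intro i b
    simp only [incidence]
    split_ifs with h1 h2
    · exact absurd (h1.symm.trans h2) (by simp)
    all_goals simp
  have ho : ∀ e : Fin m, ∀ b, Function.Injective (s e) → incidence s (.inr e) b ≤ 1 := by
    intro e b he
    simp only [incidence]
    exact Finset.card_le_one.2 fun j hj j' hj' => he (by simp_all)
  rcases p with ⟨p, (i | e) | b⟩ <;> rcases q with ⟨q, (i' | e') | b'⟩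
  · exact Nat.zero_le _
  · exact Nat.zero_le _
  · exact hh _ _
  · exact Nat.zero_le _
  · exact Nat.zero_le _
  · exact ho _ _ (slots_injective hL hu hul)
  · exact hh _ _
  · exact ho _ _ (slots_injective hL hv hvl)
  · exact Nat.zero_le _

/-- The map sends an address to the endpoint of its walk. The extra level in `d + 1 ≤ L` serves
vertices at depth exactly `d`: excluding edges outside the tree and multiple edges there requires
looking at their children. -/
theorem isom_ball_of_walkInjective (a b c : Prop) (hn : 2 ≤ n) {d : ℕ} (hd : d + 1 ≤ L)
    (hL : WalkInjective s r L) :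
    RootedGraph.Isom a b c ((tree (k + 1) ℓ (gType r) (offspring s r)).ball d)
      ((incidenceGraph ℓ s r).ball d) := by
  have hsome : ∀ u, (nodeInfo (k + 1) (gType r) (offspring s r) u).isSome →
      ∃ q, walk s r u = some q := by
    intro u hu
    rw [nodeInfo_offspring, Option.isSome_map] at hu
    exact Option.isSome_iff_exists.1 hu
  choose! g hg using hsome
  have hlen : ∀ u : ((tree (k + 1) ℓ (gType r) (offspring s r)).ball d).V, u.1.1.length ≤ d :=
    fun u => (edist_root_le_iff _ _ _ _ u.1 d).1 u.2
  let F : ((tree (k + 1) ℓ (gType r) (offspring s r)).ball d).V →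
      ((incidenceGraph ℓ s r).ball d).V := fun u =>
    ⟨(g u.1.1).2, (edist_walk_le ℓ s r (hg _ u.1.2)).trans (by exact_mod_cast hlen u)⟩
  have hF : Function.Bijective F := by
    constructor
    · intro u v huv
      have := hL _ _ _ _ (by have := hlen u; omega) (by have := hlen v; omega)
        (hg _ u.1.2) (hg _ v.1.2) (congrArg Subtype.val huv)
      exact Subtype.ext (Subtype.ext this)
    · rintro ⟨v, hv⟩
      have hne : (incidenceGraph ℓ s r).toSimpleGraph.edist (incidenceGraph ℓ s r).root v ≠ ⊤ :=
        (hv.trans_lt (ENat.natCast_lt_top d)).ne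
      obtain ⟨w, hw⟩ := SimpleGraph.exists_walk_of_edist_ne_top hne
      rw [← hw] at hv
      obtain ⟨u, q, hu, hul⟩ := exists_walk_of_graphWalk ℓ s r w (u := []) (p := none) rfl
      have hui : (nodeInfo (k + 1) (gType r) (offspring s r) u).isSome := by
        rw [nodeInfo_offspring, hu]
        rfl
      have h1 : w.length ≤ d := by exact_mod_cast hv
      refine ⟨⟨⟨u, hui⟩, (edist_root_le_iff _ _ _ _ _ d).2 ?_⟩, Subtype.ext ?_⟩
      · simp only [List.length_nil] at hul
        show u.length ≤ d
        omega
      · show (g u).2 = v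
        exact congrArg Prod.snd (Option.some.inj ((hg u hui).symm.trans hu))
  have htype : ∀ u : ((tree (k + 1) ℓ (gType r) (offspring s r)).ball d).V,
      ((nodeInfo (k + 1) (gType r) (offspring s r) u.1.1).get u.1.2).2 = gType (g u.1.1).2 := by
    intro u
    have : nodeInfo (k + 1) (gType r) (offspring s r) u.1.1 =
        some ((g u.1.1).1.map gType, gType (g u.1.1).2) := by
      rw [nodeInfo_offspring, hg _ u.1.2]
      rfl
    simp [this]
  refine RootedGraph.Isom.of_equiv a b c (Equiv.ofBijective F hF) (Subtype.ext ?_) ?_ htype ?_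
  · show (g []).2 = r
    have := hg [] rfl
    simp only [walk, Option.some.injEq] at this
    rw [← this]
  · intro u v
    show (tree (k + 1) ℓ (gType r) (offspring s r)).mult u.1 v.1 =
      (incidenceGraph ℓ s r).mult (g u.1.1).2 (g v.1.1).2
    have hu := hg _ u.1.2
    have hv := hg _ v.1.2
    have hul := hlen u
    have hvl := hlen v
    have hle := mult_le_one ℓ hn hL hu hv (by omega) (by omega)
    have hpar : ∀ {x y : List ℕ} {p q : Option (GVertex n m) × GVertex n m}, IsParent x y →
        walk s r x = some p → walk s r y = some q → (incidenceGraph ℓ s r).mult p.2 q.2 ≠ 0 := by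
      rintro x y p q ⟨i, rfl⟩ hx hy
      obtain ⟨p', v', h1, h2, h3⟩ := (walk_cons s r).1 hy
      obtain rfl : p = (p', v') := by simpa [hx] using h1
      exact adj_of_mem_children ℓ s r (walk_adj ℓ s r hx) (List.mem_of_getElem? h3)
    have hiff : (IsParent u.1.1 v.1.1 ∨ IsParent v.1.1 u.1.1) ↔
        (incidenceGraph ℓ s r).mult (g u.1.1).2 (g v.1.1).2 ≠ 0 := by
      constructor
      · rintro (h | h)
        · exact hpar h hu hv
        · exact fun h0 => hpar h hv hu (((incidenceGraph ℓ s r).mult_symm _ _).trans h0)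
      · exact isParent_of_adj ℓ hL hu hv (by omega) (by omega)
    by_cases h : IsParent u.1.1 v.1.1 ∨ IsParent v.1.1 u.1.1
    · have h1 : (tree (k + 1) ℓ (gType r) (offspring s r)).mult u.1 v.1 = 1 := if_pos h
      have h2 := hiff.1 h
      rw [h1]
      exact le_antisymm (Nat.one_le_iff_ne_zero.2 h2) hle
    · have h1 : (tree (k + 1) ℓ (gType r) (offspring s r)).mult u.1 v.1 = 0 := if_neg h
      rw [h1]
      exact (not_not.1 (mt hiff.2 h)).symm
  · intro u
    exact congrArg (weightOf ℓ) (htype u)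

end Ball

/-! ### Truncated offspring numbers -/

section Truncation

variable (k L : ℕ) (t : VType)

theorem finite_nodes (X : List ℕ → ℕ) :
    {u : List ℕ | u.length ≤ L ∧ (nodeInfo k t X u).isSome}.Finite := by
  induction L with
  | zero =>
    refine (Set.finite_singleton []).subset ?_
    rintro u ⟨hu, -⟩
    simpa using hu
  | succ L ih =>
    let f : List ℕ → Set (List ℕ) := fun u =>
      (fun i => i :: u) '' {i | ∃ q, nodeInfo k t X u = some q ∧
        i < (childTypes k (X u) q.1 q.2).length}
    have hf : ∀ u, (f u).Finite := by
      intro u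
      refine Set.Finite.image _ ?_
      rcases nodeInfo k t X u with _ | q
      · simp
      · refine (Set.finite_lt_nat (childTypes k (X u) q.1 q.2).length).subset ?_
        rintro i ⟨q', hq', hi⟩
        obtain rfl := Option.some.inj hq'
        exact hi
    refine ((ih.biUnion fun u _ => hf u).union (Set.finite_singleton [])).subset ?_
    rintro (_ | ⟨i, u⟩) ⟨hu, hs⟩
    · exact .inr rfl
    · left
      obtain ⟨q, hq⟩ := Option.isSome_iff_exists.1 hs
      obtain ⟨p, a, h1, -, h2⟩ := (nodeInfo_cons k t X).1 hq
      refine Set.mem_biUnion (x := u) ⟨by simpa using hu, by simp [h1]⟩ ⟨i, ⟨_, h1, ?_⟩, rfl⟩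
      exact (List.getElem?_eq_some_iff.1 h2).1

theorem finite_tables (X : List ℕ → ℕ) :
    {u : List ℕ | u.length < L ∧ ∃ p, nodeInfo k t X u = some (p, .table)}.Finite :=
  (finite_nodes k L t X).subset fun _ ⟨h, _, hp⟩ => ⟨h.le, by simp [hp]⟩

/-- The vertices of type `B` at depth less than `L`. -/
noncomputable def tables (X : List ℕ → ℕ) : Finset (List ℕ) :=
  (finite_tables k L t X).toFinset

theorem mem_tables {X : List ℕ → ℕ} {u : List ℕ} :
    u ∈ tables k L t X ↔ u.length < L ∧ ∃ p, nodeInfo k t X u = some (p, .table) := by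
  simp [tables]

/-- The offspring numbers used at depth less than `L`, and `0` elsewhere. -/
noncomputable def trunc (X : List ℕ → ℕ) : List ℕ →₀ ℕ :=
  Finsupp.onFinset (tables k L t X) (fun u => open Classical in
    if u ∈ tables k L t X then X u else 0) fun u hu => by
      by_contra h
      simp [h] at hu

theorem trunc_of_mem {X : List ℕ → ℕ} {u : List ℕ} (h : u ∈ tables k L t X) :
    trunc k L t X u = X u := by
  simp [trunc, h]

theorem trunc_of_notMem {X : List ℕ → ℕ} {u : List ℕ} (h : u ∉ tables k L t X) :
    trunc k L t X u = 0 := by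
  simp [trunc, h]

variable {k L t}

theorem childTypes_congr {x y : ℕ} {p : Option VType} {a : VType} (h : a = .table → x = y) :
    childTypes k x p a = childTypes k y p a := by
  cases a with
  | table => rw [h rfl]
  | _ => rcases p with _ | _ <;> rfl

/-- Only tables consult their offspring number, and nodes up to depth `L` only involve tables at
smaller depth. -/
theorem nodeInfo_congr {x X : List ℕ → ℕ} (h : ∀ u ∈ tables k L t x, X u = x u) {u : List ℕ}
    (hu : u.length ≤ L) : nodeInfo k t X u = nodeInfo k t x u := by
  induction u with
  | nil => rfl
  | cons i u ih =>
    rw [List.length_cons] at hu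
    rw [nodeInfo, nodeInfo, ih (by omega)]
    refine Option.bind_congr fun q hq => ?_
    rw [childTypes_congr]
    intro hq2
    exact h u ((mem_tables k L t).2 ⟨by omega, q.1, by rw [hq, ← hq2]⟩)

theorem tables_congr {x X : List ℕ → ℕ} (h : ∀ u ∈ tables k L t x, X u = x u) :
    tables k L t X = tables k L t x := by
  ext u
  simp only [mem_tables]
  exact and_congr_right fun hu => by rw [nodeInfo_congr h hu.le]

theorem trunc_congr {x X : List ℕ → ℕ} (h : ∀ u ∈ tables k L t x, X u = x u) :
    trunc k L t X = trunc k L t x := by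
  ext u
  by_cases hu : u ∈ tables k L t x
  · rw [trunc_of_mem k L t hu, trunc_of_mem k L t (by rwa [tables_congr h]), h u hu]
  · rw [trunc_of_notMem k L t hu, trunc_of_notMem k L t (by rwa [tables_congr h])]

theorem tables_trunc (X : List ℕ → ℕ) : tables k L t (trunc k L t X) = tables k L t X :=
  tables_congr fun _ hu => trunc_of_mem k L t hu

theorem trunc_trunc (X : List ℕ → ℕ) : trunc k L t (trunc k L t X) = trunc k L t X :=
  trunc_congr fun _ hu => trunc_of_mem k L t hu

/-- The tables that matter can be read off `x`, so fixing the truncation constrains a fixed finite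
set of coordinates. This is what makes `truncEvent` a cylinder set. -/
theorem trunc_eq_iff {x : List ℕ →₀ ℕ} (hx : trunc k L t x = x) {X : List ℕ → ℕ} :
    trunc k L t X = x ↔ ∀ u ∈ tables k L t x, X u = x u := by
  constructor
  · rintro rfl u hu
    rw [tables_trunc] at hu
    exact (trunc_of_mem k L t hu).symm
  · intro h
    rw [trunc_congr h, hx]

theorem isom_ball_trunc (ℓ : ℕ) (a b c : Prop) {d : ℕ} (hd : d ≤ L) (X : List ℕ → ℕ) :
    RootedGraph.Isom a b c ((tree k ℓ t X).ball d) ((tree k ℓ t (trunc k L t X)).ball d) := by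
  have h : ∀ {u : List ℕ}, u.length ≤ d → nodeInfo k t (trunc k L t X) u = nodeInfo k t X u :=
    fun hu => nodeInfo_congr (fun _ hu => trunc_of_mem k L t hu) (hu.trans hd)
  let f : ((tree k ℓ t X).ball d).V ≃ ((tree k ℓ t (trunc k L t X)).ball d).V :=
    { toFun := fun u => ⟨⟨u.1.1, by
          rw [h ((edist_root_le_iff _ _ _ _ _ d).1 u.2)]; exact u.1.2⟩,
        (edist_root_le_iff _ _ _ _ _ d).2 ((edist_root_le_iff _ _ _ _ u.1 d).1 u.2)⟩
      invFun := fun u => ⟨⟨u.1.1, by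
          rw [← h ((edist_root_le_iff _ _ _ _ _ d).1 u.2)]; exact u.1.2⟩,
        (edist_root_le_iff _ _ _ _ _ d).2 ((edist_root_le_iff _ _ _ _ u.1 d).1 u.2)⟩
      left_inv := fun _ => rfl
      right_inv := fun _ => rfl }
  have htype : ∀ u, ((tree k ℓ t X).ball d).vtype u =
      ((tree k ℓ t (trunc k L t X)).ball d).vtype (f u) := by
    intro u
    have := h ((edist_root_le_iff _ _ _ _ _ d).1 u.2)
    show ((nodeInfo k t X u.1.1).get _).2 = ((nodeInfo k t (trunc k L t X) u.1.1).get _).2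
    simp only [this]
  exact RootedGraph.Isom.of_equiv a b c f rfl (fun _ _ => rfl) htype
    fun u => congrArg (weightOf ℓ) (htype u)

end Truncation

/-! ### The law of the truncated tree -/

instance : Finite VType :=
  Finite.of_surjective (fun i : Fin 3 => if i = 0 then VType.helper else
    if i = 1 then VType.ordinary else VType.table) fun t => by
      cases t
      · exact ⟨0, rfl⟩
      · exact ⟨1, rfl⟩
      · exact ⟨2, rfl⟩

instance (c : ℝ≥0) : IsProbabilityMeasure (rootLaw c) := by
  constructor
  have h : (1 / (2 + c) + c / (2 + c) + 1 / (2 + c) : ℝ≥0) = 1 := by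
    have : (2 + c : ℝ≥0) ≠ 0 := by positivity
    field_simp
    ring
  simp only [rootLaw, Measure.coe_add, Measure.coe_nnreal_smul_apply, Pi.add_apply,
    measure_univ, mul_one]
  exact_mod_cast h

/-- The probability of a root type. -/
noncomputable def rootProb (c : ℝ≥0) : VType → ℝ
  | .ordinary => c / (2 + c)
  | _ => 1 / (2 + c)

theorem rootLaw_real_singleton (c : ℝ≥0) (t : VType) :
    (rootLaw c).real {t} = rootProb c t := by
  have h : ∀ a b : VType, Measure.dirac a {b} = ({b} : Set VType).indicator 1 a :=
    fun a b => Measure.dirac_apply' _ .of_discrete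
  have h' : (2 + c : ENNReal).toReal = 2 + c := by
    rw [ENNReal.toReal_add (by simp) (by simp)]
    simp
  cases t <;> simp only [rootLaw, rootProb, measureReal_def, h, Measure.coe_add, Pi.add_apply,
    Measure.coe_nnreal_smul_apply] <;> simp [h']

instance (k : ℕ) (c : ℝ≥0) : IsProbabilityMeasure (treeLaw k c) := by
  unfold treeLaw
  infer_instance

/-- The event that the truncated tree is given by `y`. -/
def truncEvent (k : ℕ) (L : VType → ℕ) (y : VType × (List ℕ →₀ ℕ)) :
    Set (VType × (List ℕ → ℕ)) :=
  {ω | ω.1 = y.1 ∧ trunc k (L ω.1) ω.1 ω.2 = y.2}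

theorem truncEvent_eq {k : ℕ} {L : VType → ℕ} {y : VType × (List ℕ →₀ ℕ)}
    (hy : trunc k (L y.1) y.1 y.2 = y.2) :
    truncEvent k L y =
      {y.1} ×ˢ Set.pi (tables k (L y.1) y.1 y.2 : Set (List ℕ)) fun u => {y.2 u} := by
  ext ⟨t, X⟩
  simp only [truncEvent, Set.mem_ofPred_eq, Set.mem_prod, Set.mem_singleton_iff, Set.mem_pi,
    Finset.mem_coe]
  refine and_congr_right ?_
  rintro rfl
  exact trunc_eq_iff hy

theorem truncEvent_eq_empty {k : ℕ} {L : VType → ℕ} {y : VType × (List ℕ →₀ ℕ)}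
    (hy : trunc k (L y.1) y.1 y.2 ≠ y.2) : truncEvent k L y = ∅ := by
  ext ⟨t, X⟩
  simp only [truncEvent, Set.mem_ofPred_eq, Set.mem_empty_iff_false, iff_false, not_and]
  rintro rfl h
  exact hy (by rw [← h, trunc_trunc])

theorem measurableSet_truncEvent (k : ℕ) (L : VType → ℕ) (y : VType × (List ℕ →₀ ℕ)) :
    MeasurableSet (truncEvent k L y) := by
  by_cases hy : trunc k (L y.1) y.1 y.2 = y.2
  · rw [truncEvent_eq hy]
    exact MeasurableSet.prod .of_discrete
      (MeasurableSet.pi (Finset.countable_toSet _) fun _ _ => .of_discrete)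
  · rw [truncEvent_eq_empty hy]
    exact .empty

theorem treeLaw_real_truncEvent {k : ℕ} (c : ℝ≥0) {L : VType → ℕ} {y : VType × (List ℕ →₀ ℕ)}
    (hy : trunc k (L y.1) y.1 y.2 = y.2) :
    (treeLaw k c).real (truncEvent k L y) = rootProb c y.1 * ∏ u ∈ tables k (L y.1) y.1 y.2,
      (Real.exp (-(k * c)) * (k * c) ^ y.2 u / (y.2 u).factorial) := by
  rw [truncEvent_eq hy, treeLaw, measureReal_prod_prod, rootLaw_real_singleton, measureReal_def,
    Measure.infinitePi_pi _ fun _ _ => .of_discrete, ENNReal.toReal_prod]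
  congr 1
  refine Finset.prod_congr rfl fun u _ => ?_
  rw [← measureReal_def, poissonMeasure_real_singleton]
  push_cast
  rfl

theorem hasSum_measureReal_iUnion {α ι : Type*} [MeasurableSpace α] [Countable ι]
    {μ : Measure α} [IsFiniteMeasure μ] {f : ι → Set α} (hd : Pairwise (Function.onFun Disjoint f))
    (hf : ∀ i, MeasurableSet (f i)) : HasSum (fun i => μ.real (f i)) (μ.real (⋃ i, f i)) := by
  have h : ∑' i, μ (f i) ≠ ⊤ := by
    rw [← measure_iUnion hd hf]
    exact measure_ne_top _ _
  rw [measureReal_def, measure_iUnion hd hf,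
    ENNReal.tsum_toReal_eq (ENNReal.ne_top_of_tsum_ne_top h)]
  exact ENNReal.hasSum_toReal h

/-- The truncation takes values in a countable type, so its fibres form a countable measurable
partition and any event expressed through it is a sum of cylinder probabilities. -/
theorem hasSum_truncEvent (k : ℕ) (c : ℝ≥0) (L : VType → ℕ)
    (S : Set (VType × (List ℕ →₀ ℕ))) :
    HasSum (S.indicator fun y => (treeLaw k c).real (truncEvent k L y))
      ((treeLaw k c).real {ω | (ω.1, trunc k (L ω.1) ω.1 ω.2) ∈ S}) := by
  classical
  have h := hasSum_measureReal_iUnion (μ := treeLaw k c)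
    (f := fun y => if y ∈ S then truncEvent k L y else ∅) ?_ ?_
  · convert! h using 1
    · ext y
      by_cases hy : y ∈ S <;> simp [hy]
    · congr 1
      ext ω
      simp only [Set.mem_ofPred_eq, Set.mem_iUnion]
      constructor
      · intro h
        exact ⟨_, by rw [if_pos h]; exact ⟨rfl, rfl⟩⟩
      · rintro ⟨y, hy⟩
        split_ifs at hy with hS
        · rcases y with ⟨t, x⟩
          obtain ⟨rfl, rfl⟩ := hy
          exact hS
        · exact hy.elim
  · intro y y' hne
    refine Set.disjoint_left.2 fun ω h h' => hne ?_
    beta_reduce at h h'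
    split_ifs at h h' <;> try exact h.elim
    · exact Prod.ext (h.1.symm.trans h'.1) (h.2.symm.trans h'.2)
    · exact h'.elim
  · intro y
    split_ifs
    · exact measurableSet_truncEvent k L y
    · exact .empty

/-! ### Convergence from lower bounds on the parts of a partition -/

/-- The Fatou half of the argument: a finite part of the sum already exceeds `x`, and on finitely
many indices the lower bounds hold simultaneously. -/
theorem eventually_le_of_hasSum_indicator {ι : Type*} {p : ι → ℝ} {S : Set ι} {b : ℝ}
    (hb : HasSum (S.indicator p) b) {P : ℕ → ι → ℝ} (hP : ∀ i, ∀ x < p i, ∀ᶠ n in atTop, x ≤ P n i)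
    {a : ℕ → ℝ} (ha : ∀ᶠ n in atTop, ∀ F : Finset ι, (F : Set ι) ⊆ S → ∑ i ∈ F, P n i ≤ a n)
    {x : ℝ} (hx : x < b) : ∀ᶠ n in atTop, x < a n := by
  classical
  obtain ⟨F, hF⟩ := (hb.eventually (lt_mem_nhds hx)).exists
  have hF' : ∑ i ∈ F, S.indicator p i = ∑ i ∈ F with i ∈ S, p i := by
    rw [Finset.sum_filter]
    rfl
  rw [hF'] at hF
  set F' := F.filter (· ∈ S)
  -- Dividing by `card + 1` rather than `card` makes the total loss `card * ε` strictly smaller than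
  -- the margin, and also covers the empty set.
  set ε := (∑ i ∈ F', p i - x) / (F'.card + 1) with hε
  have hε0 : 0 < ε := div_pos (by linarith) (by positivity)
  filter_upwards [ha, (Finset.eventually_all F').2 fun i _ => hP i (p i - ε) (by linarith)]
    with n h1 h2
  have h3 : ∑ i ∈ F', (p i - ε) ≤ ∑ i ∈ F', P n i := Finset.sum_le_sum h2
  have h4 := h1 F' (by intro i hi; simp only [F', Finset.coe_filter] at hi; exact hi.2)
  rw [Finset.sum_sub_distrib, Finset.sum_const, nsmul_eq_mul] at h3
  have h5 : (F'.card + 1) * ε = ∑ i ∈ F', p i - x := by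
    rw [hε]
    field_simp
  nlinarith

/-- The lower bound on `Sᶜ`, where the limiting mass is exactly `1 - b`, is an upper bound for `a`.
-/
theorem tendsto_of_partition {ι : Type*} {p : ι → ℝ} {S : Set ι} {b : ℝ}
    (hb : HasSum (S.indicator p) b) (hb' : HasSum (Sᶜ.indicator p) (1 - b))
    {P : ℕ → ι → ℝ} (hP : ∀ i, ∀ x < p i, ∀ᶠ n in atTop, x ≤ P n i)
    {a : ℕ → ℝ} (ha : ∀ᶠ n in atTop, ∀ F : Finset ι, (F : Set ι) ⊆ S → ∑ i ∈ F, P n i ≤ a n)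
    (ha' : ∀ᶠ n in atTop, ∀ F : Finset ι, (F : Set ι) ⊆ Sᶜ → ∑ i ∈ F, P n i ≤ 1 - a n) :
    Tendsto a atTop (𝓝 b) := by
  refine tendsto_order.2 ⟨fun x hx => eventually_le_of_hasSum_indicator hb hP ha hx,
    fun x hx => ?_⟩
  filter_upwards [eventually_le_of_hasSum_indicator hb' hP ha' (x := 1 - x) (by linarith)]
    with n hn
  linarith

/-! ### Coordinates on the tree -/

section Coordinates

/-- The number of helper children of a vertex of type `B`. -/
def nHelpers : Option VType → ℕ
  | some .helper => 1
  | _ => 2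

theorem nHelpers_le (p : Option VType) : nHelpers p ≤ 2 := by
  rcases p with _ | _ | _ | _ <;> simp [nHelpers]

theorem childTypes_table (k x : ℕ) (p : Option VType) : childTypes k x p .table =
    List.replicate (nHelpers p) .helper ++ List.replicate x .ordinary := by
  rcases p with _ | _ | _ | _ <;> rfl

theorem childTypes_helper (k x : ℕ) (p : Option VType) : childTypes k x p .helper =
    List.replicate (if p.isNone then 2 else 1) .table := by
  rcases p with _ | _ <;> rfl

theorem childTypes_ordinary (k x : ℕ) (p : Option VType) : childTypes (k + 1) x p .ordinary =
    List.replicate (if p.isNone then k + 1 else k) .table := by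
  rcases p with _ | _ <;> rfl

variable {k : ℕ} {t : VType} {X : List ℕ → ℕ}

theorem nodeInfo_nil_fst {u : List ℕ} {p : Option VType} {a : VType}
    (h : nodeInfo k t X u = some (p, a)) : p = none ↔ u = [] := by
  cases u with
  | nil => simp_all [nodeInfo]
  | cons i u =>
    obtain ⟨_, _, -, h2, -⟩ := (nodeInfo_cons k t X).1 h
    simp only at h2
    simp [h2]

theorem nodeInfo_cons_helper {i : ℕ} {u : List ℕ} {p : Option VType} :
    nodeInfo k t X (i :: u) = some (p, .helper) ↔
      p = some .table ∧ ∃ p', nodeInfo k t X u = some (p', .table) ∧ i < nHelpers p' := by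
  rw [nodeInfo_cons]
  constructor
  · rintro ⟨p', a, h1, h2, h3⟩
    cases a with
    | table =>
      refine ⟨h2, p', h1, ?_⟩
      rw [childTypes_table, List.getElem?_append] at h3
      by_contra hi
      simp [List.getElem?_replicate, hi] at h3
    | helper =>
      rw [childTypes_helper] at h3
      simp [List.getElem?_replicate] at h3
    | ordinary => rcases p' with _ | _ <;> simp [childTypes, List.getElem?_replicate] at h3
  · rintro ⟨rfl, p', h1, h2⟩
    refine ⟨p', .table, h1, rfl, ?_⟩
    rw [childTypes_table, List.getElem?_append]
    simp [h2]

theorem nodeInfo_cons_ordinary {i : ℕ} {u : List ℕ} {p : Option VType} :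
    nodeInfo k t X (i :: u) = some (p, .ordinary) ↔
      p = some .table ∧ ∃ p', nodeInfo k t X u = some (p', .table) ∧ nHelpers p' ≤ i ∧
        i < nHelpers p' + X u := by
  rw [nodeInfo_cons]
  constructor
  · rintro ⟨p', a, h1, h2, h3⟩
    cases a with
    | table =>
      refine ⟨h2, p', h1, ?_⟩
      rw [childTypes_table, List.getElem?_append] at h3
      by_cases hi : i < nHelpers p'
      · simp [hi] at h3
      · simp [List.getElem?_replicate, hi] at h3
        omega
    | helper =>
      rw [childTypes_helper] at h3
      simp [List.getElem?_replicate] at h3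
    | ordinary => rcases p' with _ | _ <;> simp [childTypes, List.getElem?_replicate] at h3
  · rintro ⟨rfl, p', h1, h2, h3⟩
    refine ⟨p', .table, h1, rfl, ?_⟩
    rw [childTypes_table, List.getElem?_append]
    simp [List.getElem?_replicate, h2]
    omega

theorem nodeInfo_cons_table {i : ℕ} {u : List ℕ} {p : Option VType} :
    nodeInfo (k + 1) t X (i :: u) = some (p, .table) ↔
      (p = some .helper ∧ ∃ p', nodeInfo (k + 1) t X u = some (p', .helper) ∧
        i < if u = [] then 2 else 1) ∨
      (p = some .ordinary ∧ ∃ p', nodeInfo (k + 1) t X u = some (p', .ordinary) ∧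
        i < if u = [] then k + 1 else k) := by
  rw [nodeInfo_cons]
  constructor
  · rintro ⟨p', a, h1, h2, h3⟩
    have hp := nodeInfo_nil_fst h1
    cases a with
    | table =>
      rw [childTypes_table] at h3
      have := List.mem_of_getElem? h3
      simp at this
    | helper =>
      refine .inl ⟨h2, p', h1, ?_⟩
      rw [childTypes_helper] at h3
      rcases p' with _ | _ <;> simp only [List.getElem?_replicate] at h3 <;> simp at h3 hp <;>
        simp [hp] <;> omega
    | ordinary =>
      refine .inr ⟨h2, p', h1, ?_⟩
      rw [childTypes_ordinary] at h3
      rcases p' with _ | _ <;> simp [List.getElem?_replicate] at h3 hp <;> simp [hp, h3]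
  · rintro (⟨rfl, p', h1, h2⟩ | ⟨rfl, p', h1, h2⟩) <;> refine ⟨p', _, h1, rfl, ?_⟩ <;>
    have hp := nodeInfo_nil_fst h1
    · rw [childTypes_helper, List.getElem?_replicate, if_pos]
      simpa [Option.isNone_iff_eq_none, hp] using h2
    · rw [childTypes_ordinary, List.getElem?_replicate, if_pos]
      simpa [Option.isNone_iff_eq_none, hp] using h2

/-- The direction in which the `i`-th child of a vertex of type `a` extends a cluster from its
head. -/
def turn : VType → ℕ → ℤ
  | .table, i => if i = 0 then 1 else -1
  | _, i => if i = 0 then -1 else 1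

/-- The coordinate of the head of a cluster. -/
def headCoord : VType → ℤ
  | .helper => 1
  | _ => 0

variable (k t X) in
/-- A cluster is a maximal set of vertices connected through helper edges. Each of its vertices is
described by the head (the vertex closest to the root), a coordinate, which is even for tables and
odd for helper edges, and a direction, which is `0` for the head. -/
def frame : List ℕ → List ℕ × ℤ × ℤ
  | [] => ([], headCoord t, 0)
  | i :: u =>
    match nodeInfo (k + 1) t X u with
    | some (_, .ordinary) => (i :: u, 0, 0)
    | some (_, a) =>
      let δ := if (frame u).2.2 = 0 then turn a i else (frame u).2.2
      ((frame u).1, (frame u).2.1 + δ, δ)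
    | none => (i :: u, 0, 0)

theorem frame_of_ordinary {i : ℕ} {u : List ℕ} {p : Option VType}
    (h : nodeInfo (k + 1) t X u = some (p, .ordinary)) : frame k t X (i :: u) = (i :: u, 0, 0) := by
  rw [frame, h]

theorem frame_of_ne_ordinary {i : ℕ} {u : List ℕ} {p : Option VType} {a : VType}
    (h : nodeInfo (k + 1) t X u = some (p, a)) (ha : a ≠ .ordinary) :
    frame k t X (i :: u) =
      ((frame k t X u).1,
        (frame k t X u).2.1 + (if (frame k t X u).2.2 = 0 then turn a i else (frame k t X u).2.2),
        if (frame k t X u).2.2 = 0 then turn a i else (frame k t X u).2.2) := by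
  rw [frame, h]
  cases a
  · rfl
  · exact absurd rfl ha
  · rfl

theorem turn_eq (a : VType) (i : ℕ) : turn a i = 1 ∨ turn a i = -1 := by
  cases a <;> simp only [turn] <;> split_ifs <;> simp

/-- The dichotomy behind all arguments on clusters: a vertex is the head of its cluster, or it
continues the cluster of its parent by one step in its direction. A cluster entered through an
ordinary edge has a table as head, so a helper edge is a head only at the root. -/
theorem frame_ordinary_or (u : List ℕ) {p : Option VType} {a : VType}
    (h : nodeInfo (k + 1) t X u = some (p, a)) (ha : a ≠ .ordinary) :
    (frame k t X u = (u, headCoord a, 0) ∧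
        p ≠ some .helper ∧ (a = .helper → u = [])) ∨
      ∃ i v q b, u = i :: v ∧ nodeInfo (k + 1) t X v = some (q, b) ∧ b ≠ .ordinary ∧
        p = some b ∧ (b = .helper ↔ a = .table) ∧
        (frame k t X u).1 = (frame k t X v).1 ∧
        (frame k t X u).2.1 = (frame k t X v).2.1 + (frame k t X u).2.2 ∧
        (frame k t X u).2.2 =
          if (frame k t X v).2.2 = 0 then turn b i else (frame k t X v).2.2 := by
  cases u with
  | nil =>
    left
    simp only [nodeInfo, Option.some.injEq, Prod.mk.injEq] at h
    obtain ⟨rfl, rfl⟩ := h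
    simp [frame]
  | cons i v =>
    cases a with
    | ordinary => exact absurd rfl ha
    | helper =>
      right
      obtain ⟨rfl, p', h1, -⟩ := nodeInfo_cons_helper.1 h
      refine ⟨i, v, p', .table, rfl, h1, by simp, rfl, by simp, ?_⟩
      rw [frame_of_ne_ordinary h1 (by simp)]
      simp
    | table =>
      rcases nodeInfo_cons_table.1 h with ⟨rfl, p', h1, -⟩ | ⟨rfl, p', h1, -⟩
      · right
        refine ⟨i, v, p', .helper, rfl, h1, by simp, rfl, by simp, ?_⟩
        rw [frame_of_ne_ordinary h1 (by simp)]
        simp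
      · left
        rw [frame_of_ordinary h1]
        simp [headCoord]

/-- A cluster consists of rays from its head, since the direction never changes after the first
step. The coordinate is therefore that of the head plus the direction times the distance to the
head, and its parity separates tables from helper edges. -/
theorem frame_spec (u : List ℕ) {p : Option VType} {a : VType}
    (h : nodeInfo (k + 1) t X u = some (p, a)) (ha : a ≠ .ordinary) :
    (frame k t X u).1 <:+ u ∧ ((frame k t X u).2.2 = 0 ↔ (frame k t X u).1 = u) ∧
      ((frame k t X u).2.2 = 0 ∨ (frame k t X u).2.2 = 1 ∨ (frame k t X u).2.2 = -1) ∧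
      (frame k t X u).2.1 = (frame k t X (frame k t X u).1).2.1 +
        (frame k t X u).2.2 * ((u.length : ℤ) - (frame k t X u).1.length) ∧
      (a = .table → (frame k t X u).2.1 % 2 = 0) ∧ (a = .helper → (frame k t X u).2.1 % 2 = 1) ∧
      (∃ p' b, nodeInfo (k + 1) t X (frame k t X u).1 = some (p', b) ∧ b ≠ .ordinary) ∧
      frame k t X (frame k t X u).1 = ((frame k t X u).1, (frame k t X (frame k t X u).1).2.1, 0) ∧
      0 ≤ (frame k t X (frame k t X u).1).2.1 ∧ (frame k t X (frame k t X u).1).2.1 ≤ 1 := by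
  induction u generalizing p a with
  | nil =>
    simp only [nodeInfo, Option.some.injEq, Prod.mk.injEq] at h
    obtain ⟨rfl, rfl⟩ := h
    cases t <;> simp [frame, nodeInfo, headCoord] at ha ⊢
  | cons i v ih =>
    rcases frame_ordinary_or _ h ha with ⟨h1, -, -⟩ | ⟨i', v', q, b, hu, h1, h2, -, h4, h5, h6, h7⟩
    · rw [h1]
      refine ⟨List.suffix_rfl, by simp, by simp, by simp [h1], ?_, ?_, ⟨p, a, h, ha⟩, ?_, ?_⟩
      · rintro rfl; rfl
      · rintro rfl; rfl
      · rw [h1]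
      · rw [h1]
        cases a <;> simp [headCoord]
    · obtain ⟨rfl, rfl⟩ := List.cons.inj hu
      obtain ⟨g1, g2, g3, g4, g5, g6, g7, g8, g9⟩ := ih h1 h2
      have hδ : (frame k t X (i :: v)).2.2 = 1 ∨ (frame k t X (i :: v)).2.2 = -1 := by
        rw [h7]
        have := turn_eq b i
        split_ifs with h0
        · exact this
        · rcases g3 with g3 | g3
          · exact absurd g3 h0
          · exact g3
      have hlen := g1.length_le
      refine ⟨?_, ?_, .inr hδ, ?_, ?_, ?_, ?_, ?_, ?_⟩
      · rw [h5]
        exact g1.trans (List.suffix_cons _ _)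
      · refine iff_of_false (by omega) fun h0 => ?_
        have := congrArg List.length h0
        rw [h5, List.length_cons] at this
        omega
      · rw [h5, h6, g4, List.length_cons]
        by_cases h0 : (frame k t X v).2.2 = 0
        · have := g2.1 h0
          rw [h0, this]
          push_cast
          ring
        · rw [if_neg h0] at h7
          rw [h7]
          push_cast
          ring
      · rintro rfl
        have := g6 (h4.2 rfl)
        omega
      · rintro rfl
        have : b = .table := by
          cases b
          · simp at h4
          · exact absurd rfl h2
          · rfl
        have := g5 this
        omega
      · rw [h5]
        exact g7
      · rw [h5]
        exact g8
      · rw [h5]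
        exact g9

/-- Induction along the ray: equal displacement from the head forces equal direction, hence the
predecessors have equal coordinates and coincide, and only the last child index remains to be
compared. -/
theorem frame_injective {u v : List ℕ} {p q : Option VType} {a b : VType}
    (hu : nodeInfo (k + 1) t X u = some (p, a)) (ha : a ≠ .ordinary)
    (hv : nodeInfo (k + 1) t X v = some (q, b)) (hb : b ≠ .ordinary)
    (h1 : (frame k t X u).1 = (frame k t X v).1)
    (h2 : (frame k t X u).2.1 = (frame k t X v).2.1) : u = v := by
  induction u generalizing v p q a b with
  | nil =>
    have hu1 : (frame k t X []).1 = [] := rfl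
    have hu2 := (frame_spec _ hu ha).2.1.2 rfl
    obtain ⟨g1, g2, g3, g4, -⟩ := frame_spec _ hv hb
    rw [← h2, ← h1, hu1, (frame_spec _ hu ha).2.2.2.1, hu1] at g4
    simp only [List.length_nil, Nat.cast_zero, sub_zero, mul_zero, add_zero, left_eq_add,
      mul_eq_zero, Nat.cast_eq_zero, List.length_eq_zero_iff] at g4
    rcases g4 with g4 | g4
    · rw [← g2.1 g4, ← h1]; rfl
    · exact g4.symm
  | cons i u ih =>
    obtain ⟨f1, f2, f3, f4, -⟩ := frame_spec _ hu ha
    obtain ⟨g1, g2, g3, g4, -⟩ := frame_spec _ hv hb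
    have hl1 := f1.length_le
    have hl2 := g1.length_le
    rw [← h1, ← h2] at g4
    rw [← h1] at hl2
    have key := f4.symm.trans g4
    have key' : (frame k t X (i :: u)).2.2 *
        (((i :: u).length : ℤ) - (frame k t X (i :: u)).1.length) =
        (frame k t X v).2.2 * ((v.length : ℤ) - (frame k t X (i :: u)).1.length) := by
      linarith
    have hlt : ∀ w, (frame k t X (i :: u)).1 <:+ w → (frame k t X (i :: u)).1 ≠ w →
        (frame k t X (i :: u)).1.length < w.length := by
      intro w hw hne
      exact lt_of_le_of_ne hw.length_le fun hl => hne (hw.eq_of_length hl)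
    rw [← h1] at g1 g2
    by_cases hu0 : (frame k t X (i :: u)).2.2 = 0
    · rw [hu0, zero_mul] at key'
      by_cases hv0 : (frame k t X v).2.2 = 0
      · rw [← f2.1 hu0, ← g2.1 hv0]
      · have := hlt v g1 (mt g2.2 hv0)
        rcases mul_eq_zero.1 key'.symm with h | h
        · exact absurd h hv0
        · omega
    · have hlu := hlt _ f1 (mt f2.2 hu0)
      have hv0 : (frame k t X v).2.2 ≠ 0 := by
        intro hv0
        rw [hv0, zero_mul] at key'
        rcases mul_eq_zero.1 key' with h | h
        · exact hu0 h
        · omega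
      have hlv := hlt _ g1 (mt g2.2 hv0)
      have hδ : (frame k t X (i :: u)).2.2 = (frame k t X v).2.2 := by
        rcases f3 with f3 | f3 | f3
        · exact absurd f3 hu0
        all_goals
          rcases g3 with g3 | g3 | g3
          · exact absurd g3 hv0
          all_goals
            rw [f3, g3] at key' ⊢
            try omega
      rcases frame_ordinary_or _ hu ha with ⟨e1, -, -⟩ | ⟨i', u', p', a', e1, e2, e3, e4, e4', e5, e6, e7⟩
      · rw [e1] at hu0
        exact absurd rfl hu0
      rcases frame_ordinary_or _ hv hb with ⟨d1, -, -⟩ | ⟨j, v', q', b', d1, d2, d3, d4, d4', d5, d6, d7⟩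
      · rw [d1] at hv0
        exact absurd rfl hv0
      obtain ⟨rfl, rfl⟩ := List.cons.inj e1
      subst d1
      obtain rfl := ih e2 e3 d2 d3 (by rw [← e5, ← d5, h1]) (by linarith)
      obtain ⟨rfl, rfl⟩ : p' = q' ∧ a' = b' := by simpa [e2] using d2
      congr 1
      -- At a head there are at most two continuations, told apart by `turn`; away from the head the
      -- only continuation within the cluster has index 0.
      have hi : ∀ {j q b}, nodeInfo (k + 1) t X (j :: u) = some (q, b) → b ≠ .ordinary → j < 2 ∧
          ((frame k t X u).2.2 ≠ 0 → j = 0) := by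
        intro j q b h hb
        cases b with
        | ordinary => exact absurd rfl hb
        | helper =>
          obtain ⟨-, p'', h3, h4⟩ := nodeInfo_cons_helper.1 h
          refine ⟨h4.trans_le (nHelpers_le _), fun h5 => ?_⟩
          rcases frame_ordinary_or _ h3 (by simp) with ⟨h6, -⟩ | ⟨_, _, _, b, _, _, _, h7, h8, _⟩
          · simp [h6] at h5
          · rw [h7, h8.2 rfl, nHelpers] at h4
            omega
        | table =>
          rcases nodeInfo_cons_table.1 h with ⟨-, p'', h3, h4⟩ | ⟨-, p'', h3, h4⟩
          · refine ⟨h4.trans_le (by split_ifs <;> simp), fun h5 => ?_⟩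
            rw [if_neg] at h4
            · omega
            · rintro rfl
              simp [frame] at h5
          · rw [e2] at h3
            simp only [Option.some.injEq, Prod.mk.injEq] at h3
            exact absurd h3.2 e3
      obtain ⟨hi1, hi2⟩ := hi hu ha
      obtain ⟨hj1, hj2⟩ := hi hv hb
      by_cases h0 : (frame k t X u).2.2 = 0
      · rw [e7, d7, if_pos h0, if_pos h0] at hδ
        cases a' <;> simp only [turn] at hδ <;> split_ifs at hδ <;> omega
      · rw [hi2 h0, hj2 h0]

end Coordinates

/-! ### Prescribing the unfolding -/

section Embedding

variable {n m : ℕ} (k : ℕ) (t : VType) (X : List ℕ → ℕ)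

/-- The position of a helper edge or a table, if the heads of the clusters are placed by `Q`. -/
def pos (Q : List ℕ → ZMod n) (u : List ℕ) : ZMod n :=
  Q (frame k t X u).1 + (((frame k t X u).2.1 / 2 : ℤ) : ZMod n)

/-- The map from the tree to the graph that is given by the positions `Q` of the heads of the
clusters and the names `E` of the ordinary edges. -/
def embed (Q : List ℕ → ZMod n) (E : List ℕ → Fin m) (u : List ℕ) : GVertex n m :=
  match nodeInfo (k + 1) t X u with
  | some (_, .helper) => .inl (.inl (pos k t X Q u))
  | some (_, .ordinary) => .inl (.inr (E u))
  | _ => .inr (pos k t X Q u)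

/-- The image of the parent. -/
def embedParent (Q : List ℕ → ZMod n) (E : List ℕ → Fin m) : List ℕ → Option (GVertex n m)
  | [] => none
  | _ :: v => some (embed k t X Q E v)

/-- The content of the ordinary edge `u`, if its parent is in the slot `W u`. -/
def row (Q : List ℕ → ZMod n) (W : List ℕ → Fin (k + 1)) : List ℕ → Fin (k + 1) → ZMod n
  | [] => fun j => Q [j.1]
  | i :: v => (W (i :: v)).insertNth (α := fun _ => ZMod n) (pos k t X Q v)
      fun j => Q (j.1 :: i :: v)

/-- The placement `(Q, E)` is injective and lists the ordinary children of each table in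
increasing order. -/
structure Admissible (L : ℕ) (Q : List ℕ → ZMod n) (E : List ℕ → Fin m) : Prop where
  injective : ∀ u v, u.length ≤ L → v.length ≤ L → (nodeInfo (k + 1) t X u).isSome →
    (nodeInfo (k + 1) t X v).isSome → embed k t X Q E u = embed k t X Q E v → u = v
  increasing : ∀ i j u p q, u.length < L → i < j →
    nodeInfo (k + 1) t X (i :: u) = some (p, .ordinary) →
    nodeInfo (k + 1) t X (j :: u) = some (q, .ordinary) → E (i :: u) < E (j :: u)

/-- The outcome `s` realizes the placement `(Q, E, W)`. -/
structure Realizes (L : ℕ) (Q : List ℕ → ZMod n) (E : List ℕ → Fin m)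
    (W : List ℕ → Fin (k + 1)) (s : Fin m → Fin (k + 1) → ZMod n) : Prop where
  row_eq : ∀ u p, u.length ≤ L → nodeInfo (k + 1) t X u = some (p, .ordinary) →
    s (E u) = row k t X Q W u
  avoid : ∀ e, (∀ u p, u.length ≤ L → nodeInfo (k + 1) t X u = some (p, .ordinary) → E u ≠ e) →
    ∀ j, ∀ u ∈ tables (k + 1) L t X, s e j ≠ pos k t X Q u

variable {k t X} {Q : List ℕ → ZMod n} {E : List ℕ → Fin m} {W : List ℕ → Fin (k + 1)}
  {s : Fin m → Fin (k + 1) → ZMod n} {L : ℕ}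

theorem embed_helper {u : List ℕ} {p : Option VType}
    (h : nodeInfo (k + 1) t X u = some (p, .helper)) :
    embed k t X Q E u = .inl (.inl (pos k t X Q u)) := by
  rw [embed, h]

theorem embed_ordinary {u : List ℕ} {p : Option VType}
    (h : nodeInfo (k + 1) t X u = some (p, .ordinary)) :
    embed k t X Q E u = .inl (.inr (E u)) := by
  rw [embed, h]

theorem embed_table {u : List ℕ} {p : Option VType}
    (h : nodeInfo (k + 1) t X u = some (p, .table)) :
    embed k t X Q E u = .inr (pos k t X Q u) := by
  rw [embed, h]

theorem gType_embed {u : List ℕ} {p : Option VType} {a : VType}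
    (h : nodeInfo (k + 1) t X u = some (p, a)) : gType (embed k t X Q E u) = a := by
  cases a
  · rw [embed_helper h]; rfl
  · rw [embed_ordinary h]; rfl
  · rw [embed_table h]; rfl

theorem pos_of_ordinary {i : ℕ} {u : List ℕ} {p : Option VType}
    (h : nodeInfo (k + 1) t X u = some (p, .ordinary)) : pos k t X Q (i :: u) = Q (i :: u) := by
  simp [pos, frame_of_ordinary h]

/-- Vertices of type `A_C` and `A_R` have depth less than `L`. -/
def EndsWithTables (k L : ℕ) (t : VType) (X : List ℕ → ℕ) : Prop :=
  ∀ u p a, u.length = L → nodeInfo (k + 1) t X u = some (p, a) → a = .table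

theorem EndsWithTables.lt (hL : EndsWithTables k L t X) {u : List ℕ} {p : Option VType} {a : VType}
    (hu : u.length ≤ L) (h : nodeInfo (k + 1) t X u = some (p, a)) (ha : a ≠ .table) :
    u.length < L :=
  lt_of_le_of_ne hu fun h' => ha (hL u p a h' h)

theorem Admissible.eq_of_pos_eq (hA : Admissible k t X L Q E) {u v : List ℕ} {p q : Option VType}
    (hu : u.length ≤ L) (hv : v.length ≤ L) (hup : nodeInfo (k + 1) t X u = some (p, .table))
    (hvq : nodeInfo (k + 1) t X v = some (q, .table))
    (h : pos k t X Q u = pos k t X Q v) : u = v :=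
  hA.injective u v hu hv (by simp [hup]) (by simp [hvq])
    (by rw [embed_table hup, embed_table hvq, h])

/-- At the root the two tables are the coordinates 0 and 2 around the head at 1. Elsewhere the
parent and the child have coordinates on either side of an odd number, so their halves add up to `2
* i + 1`, as `children` requires. -/
theorem children_embed_helper {u : List ℕ} {p : Option VType}
    (hu : nodeInfo (k + 1) t X u = some (p, .helper)) :
    children s (embedParent k t X Q E u) (embed k t X Q E u) =
      (List.range (if u = [] then 2 else 1)).map fun i => embed k t X Q E (i :: u) := by
  have hc : ∀ i < (if u = [] then 2 else 1),
      embed k t X Q E (i :: u) = .inr (pos k t X Q (i :: u)) := fun i hi =>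
    embed_table (nodeInfo_cons_table.2 (.inl ⟨rfl, p, hu, hi⟩))
  rw [embed_helper hu]
  rcases frame_ordinary_or _ hu (by simp) with
    ⟨h1, -, h2⟩ | ⟨i, v, q, b, rfl, h1, h2, h3, h4, h5, h6, h7⟩
  · obtain rfl := h2 rfl
    simp only [if_true] at hc ⊢
    simp only [List.range_succ, List.range_zero, List.nil_append, List.cons_append,
      List.map_cons, List.map_nil, hc 0 (by simp), hc 1 (by simp), embedParent, children]
    have hf := frame_of_ne_ordinary (i := 0) hu (by simp)
    have hf' := frame_of_ne_ordinary (i := 1) hu (by simp)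
    rw [h1] at hf hf'
    simp [pos, hf, hf', h1, headCoord, turn]
  · have hv := hc 0 (by simp)
    obtain rfl : b = .table := by
      cases b
      · simp at h4
      · exact absurd rfl h2
      · rfl
    have hf := frame_of_ne_ordinary (i := 0) hu (by simp)
    obtain ⟨-, g2, g3, -, -, g6, -⟩ := frame_spec _ hu (by simp)
    obtain ⟨-, -, -, -, k5, -⟩ := frame_spec _ h1 (by simp)
    have g6 := g6 rfl
    have k5 := k5 rfl
    have hδ : (frame k t X (i :: v)).2.2 ≠ 0 := by omega
    rw [if_neg hδ] at hf
    simp only [List.cons_ne_nil, if_false, List.range_succ, List.range_zero, List.nil_append,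
      List.map_cons, List.map_nil, hv, embedParent, children, embed_table h1, coord]
    congr 2
    have hz : (frame k t X (0 :: i :: v)).2.1 / 2 =
        2 * ((frame k t X (i :: v)).2.1 / 2) + 1 - (frame k t X v).2.1 / 2 := by
      rw [hf]
      show ((frame k t X (i :: v)).2.1 + (frame k t X (i :: v)).2.2) / 2 = _
      omega
    simp only [pos, hz, h5]
    rw [hf]
    simp only [h5]
    push_cast
    ring

/-- Floor division is essential here: the helper edges at coordinates `±1` around a table get
positions `b` and `b - 1`. Away from a head the halves on the two sides of the even coordinate add
up to `2 * b - 1`. -/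
theorem helperChildren_embed {u : List ℕ} {p : Option VType}
    (hu : nodeInfo (k + 1) t X u = some (p, .table)) :
    helperChildren (embedParent k t X Q E u) (pos k t X Q u) =
      (List.range (nHelpers p)).map fun i => embed k t X Q E (i :: u) := by
  have hc : ∀ i < nHelpers p,
      embed k t X Q E (i :: u) = .inl (.inl (pos k t X Q (i :: u))) := fun i hi =>
    embed_helper (nodeInfo_cons_helper.2 ⟨rfl, p, hu, hi⟩)
  rcases frame_ordinary_or _ hu (by simp) with
    ⟨h1, h2, -⟩ | ⟨i, v, q, b, rfl, h1, h2, h3, h4, h5, h6, h7⟩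
  · have hn : nHelpers p = 2 := by
      rcases p with _ | _ | _ | _ <;> first | rfl | exact absurd rfl h2
    have hh : helperChildren (embedParent k t X Q E u) (pos k t X Q u) =
        [.inl (.inl (pos k t X Q u)), .inl (.inl (pos k t X Q u - 1))] := by
      cases u with
      | nil => rfl
      | cons i v =>
        rcases nodeInfo_cons_table.1 hu with ⟨rfl, _⟩ | ⟨rfl, p', h3, -⟩
        · exact absurd rfl h2
        · rw [embedParent, embed_ordinary h3]
          rfl
    rw [hn] at hc ⊢
    simp only [hh, List.range_succ, List.range_zero, List.nil_append, List.cons_append,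
      List.map_cons, List.map_nil, hc 0 (by simp), hc 1 (by simp)]
    have hf := frame_of_ne_ordinary (i := 0) hu (by simp)
    have hf' := frame_of_ne_ordinary (i := 1) hu (by simp)
    rw [h1] at hf hf'
    simp [pos, hf, hf', h1, headCoord, turn, sub_eq_add_neg]
  · obtain rfl := h4.2 rfl
    subst h3
    have hv := hc 0 (by simp [nHelpers])
    have hf := frame_of_ne_ordinary (i := 0) hu (by simp)
    obtain ⟨-, g2, g3, -, g5, -⟩ := frame_spec _ hu (by simp)
    obtain ⟨-, -, -, -, -, k6, -⟩ := frame_spec _ h1 (by simp)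
    have g5 := g5 rfl
    have k6 := k6 rfl
    have hδ : (frame k t X (i :: v)).2.2 ≠ 0 := by omega
    rw [if_neg hδ] at hf
    simp only [nHelpers, List.range_succ, List.range_zero, List.nil_append,
      List.map_cons, List.map_nil, hv, embedParent, embed_helper h1, helperChildren]
    congr 3
    have hz : (frame k t X (0 :: i :: v)).2.1 / 2 =
        2 * ((frame k t X (i :: v)).2.1 / 2) - 1 - (frame k t X v).2.1 / 2 := by
      rw [hf]
      show ((frame k t X (i :: v)).2.1 + (frame k t X (i :: v)).2.2) / 2 = _
      omega
    simp only [pos, hz, h5]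
    rw [hf]
    simp only [h5]
    push_cast
    ring

theorem children_embed_ordinary (hL : EndsWithTables k L t X) (hA : Admissible k t X L Q E)
    (hR : Realizes k t X L Q E W s) {u : List ℕ} {p : Option VType} (hul : u.length ≤ L)
    (hu : nodeInfo (k + 1) t X u = some (p, .ordinary)) :
    children s (embedParent k t X Q E u) (embed k t X Q E u) =
      (List.range (if u = [] then k + 1 else k)).map fun i => embed k t X Q E (i :: u) := by
  have hlt := hL.lt hul hu (by simp)
  have hn : ∀ i < (if u = [] then k + 1 else k),
      nodeInfo (k + 1) t X (i :: u) = some (some .ordinary, .table) := fun i hi =>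
    nodeInfo_cons_table.2 (.inr ⟨rfl, p, hu, hi⟩)
  have hc : ∀ i < (if u = [] then k + 1 else k),
      embed k t X Q E (i :: u) = .inr (Q (i :: u)) := fun i hi => by
    rw [embed_table (hn i hi), pos_of_ordinary hu]
  have hrow := hR.row_eq u p hul hu
  rw [embed_ordinary hu]
  cases u with
  | nil =>
    simp only [if_true] at hc ⊢
    simp only [embedParent, children, hrow, row]
    refine List.ext_getElem (by simp) fun i h1 h2 => ?_
    simp only [List.length_ofFn] at h1
    simp only [List.getElem_ofFn, List.getElem_map, List.getElem_range]
    exact (hc i h1).symm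
  | cons j v =>
    simp only [List.cons_ne_nil, if_false] at hc hn ⊢
    obtain ⟨-, p', hv, -⟩ := nodeInfo_cons_ordinary.1 hu
    -- The parent occurs in no slot other than `W`: the other slots contain children, and equality
    -- of positions would identify a child with its grandparent.
    have hslot : parentSlot s (E (j :: v)) (pos k t X Q v) = W (j :: v) := by
      by_contra hne
      obtain ⟨i, hi⟩ := Fin.exists_succAbove_eq hne
      have hspec := parentSlot_spec s (e := E (j :: v)) (b := pos k t X Q v)
        ⟨W (j :: v), by rw [hrow, row, Fin.insertNth_apply_same]⟩
      rw [← hi, hrow, row, Fin.insertNth_apply_succAbove,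
        ← pos_of_ordinary (Q := Q) hu] at hspec
      have := hA.eq_of_pos_eq (by simpa using hlt) (by simp only [List.length_cons] at hul; omega)
        (hn i i.2) hv hspec
      have := congrArg List.length this
      simp only [List.length_cons] at this
      omega
    simp only [embedParent, children, embed_table hv, coord, hslot]
    simp only [hrow, row, Fin.insertNth_apply_succAbove]
    refine List.ext_getElem (by simp) fun i h1 h2 => ?_
    simp only [List.length_ofFn] at h1
    simp only [List.getElem_ofFn, List.getElem_map, List.getElem_range]
    exact (hc i h1).symm

/-- An ordinary edge through this table must be one of the tree, by `avoid`. The table then sits in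
the parent slot, making the edge a child, or in a child slot, making it the parent, which is
excluded. The increasing naming makes the sorted order agree with the addresses. -/
theorem sort_ordinaryChildren_embed (hL : EndsWithTables k L t X) (hA : Admissible k t X L Q E)
    (hR : Realizes k t X L Q E W s) {u : List ℕ} {p : Option VType} (hul : u.length < L)
    (hu : nodeInfo (k + 1) t X u = some (p, .table)) :
    (ordinaryChildren s (embedParent k t X Q E u) (pos k t X Q u)).sort (· ≤ ·) =
      (List.range (X u)).map fun i => E ((nHelpers p + i) :: u) := by
  have hn : ∀ i < X u,
      nodeInfo (k + 1) t X ((nHelpers p + i) :: u) = some (some .table, .ordinary) := fun i hi => nodeInfo_cons_ordinary.2 ⟨rfl, p, hu, by omega, by omega⟩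
  set l := (List.range (X u)).map fun i => E ((nHelpers p + i) :: u) with hl
  have hlt : l.Pairwise (· < ·) := by
    rw [hl, List.pairwise_map, List.pairwise_iff_getElem]
    intro i j hi hj hij
    simp only [List.length_range] at hi hj
    simp only [List.getElem_range]
    exact hA.increasing _ _ u _ _ hul (by omega) (hn i hi) (hn j hj)
  have hset : ordinaryChildren s (embedParent k t X Q E u) (pos k t X Q u) = l.toFinset := by
    ext e
    simp only [ordinaryChildren, Finset.mem_filter, Finset.mem_univ, true_and, List.mem_toFinset,
      hl, List.mem_map, List.mem_range]
    constructor
    · rintro ⟨⟨j, hj⟩, hpe⟩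
      by_cases he : ∀ w q, w.length ≤ L → nodeInfo (k + 1) t X w = some (q, .ordinary) → E w ≠ e
      · exact absurd hj (hR.avoid e he j u ((mem_tables _ _ _).2 ⟨hul, p, hu⟩))
      push Not at he
      obtain ⟨w, q, hw, hwq, rfl⟩ := he
      rw [hR.row_eq w q hw hwq] at hj
      have hwlt := hL.lt hw hwq (by simp)
      -- If a child of `w` were placed at the table `u`, injectivity would make `u` that child, so
      -- that `w` is the excluded parent.
      have hpar : ∀ i, i < (if w = [] then k + 1 else k) → Q (i :: w) ≠ pos k t X Q u := by
        intro i hi h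
        rw [← pos_of_ordinary (Q := Q) hwq] at h
        have := hA.eq_of_pos_eq (by simpa using hwlt) hul.le
          (nodeInfo_cons_table.2 (.inr ⟨rfl, q, hwq, hi⟩)) hu h
        subst this
        exact hpe (by rw [embedParent, embed_ordinary hwq])
      cases w with
      | nil => exact absurd hj (hpar j j.2)
      | cons i v =>
        obtain ⟨-, p', hv, hi1, hi2⟩ := nodeInfo_cons_ordinary.1 hwq
        by_cases hjW : j = W (i :: v)
        · rw [hjW, row, Fin.insertNth_apply_same] at hj
          obtain rfl := hA.eq_of_pos_eq (by simp only [List.length_cons] at hw; omega) hul.le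
            hv hu hj
          obtain rfl : p = p' := by simpa [hu] using hv
          exact ⟨i - nHelpers p, by omega, by rw [Nat.add_sub_cancel' hi1]⟩
        · obtain ⟨j', rfl⟩ := Fin.exists_succAbove_eq hjW
          rw [row, Fin.insertNth_apply_succAbove] at hj
          exact absurd hj (hpar j' j'.2)
    · rintro ⟨i, hi, rfl⟩
      refine ⟨⟨W ((nHelpers p + i) :: u), ?_⟩, ?_⟩
      · rw [hR.row_eq _ _ (by simpa using hul) (hn i hi), row, Fin.insertNth_apply_same]
      · cases u with
        | nil => simp [embedParent]
        | cons j v =>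
          rw [embedParent, Ne, Option.some.injEq, ← embed_ordinary (hn i hi)]
          intro h
          have := hA.injective v _ (by simp only [List.length_cons] at hul; omega)
            (by simpa using hul) (isSome_nodeInfo_of_cons _ _ _ (i := j) (by simp [hu]))
            (by simp [hn i hi]) h
          have := congrArg List.length this
          simp only [List.length_cons] at this
          omega
  rw [hset, List.toFinset_sort _ hlt.nodup]
  exact hlt.imp le_of_lt

/-- The three computations of `children` agree with the placement of the tree, so the walk follows
it by induction. All parents involved have depth less than `L`, where the placement is fully
controlled. -/
theorem walk_embed (hL : EndsWithTables k L t X) (hA : Admissible k t X L Q E)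
    (hR : Realizes k t X L Q E W s) {u : List ℕ} (hul : u.length ≤ L)
    (hu : (nodeInfo (k + 1) t X u).isSome) :
    walk s (embed k t X Q E []) u = some (embedParent k t X Q E u, embed k t X Q E u) := by
  induction u with
  | nil => rfl
  | cons i u ih =>
    have hul' : u.length < L := by simpa using hul
    rw [walk_cons]
    refine ⟨_, _, ih hul'.le (isSome_nodeInfo_of_cons _ _ _ hu), rfl, ?_⟩
    obtain ⟨⟨p, a⟩, hpa⟩ := Option.isSome_iff_exists.1 hu
    have key : ∀ N, i < N → ((List.range N).map fun i => embed k t X Q E (i :: u))[i]? =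
        some (embed k t X Q E (i :: u)) := by
      intro N hi
      simp [hi]
    have hch : ∀ p', nodeInfo (k + 1) t X u = some (p', .table) →
        children s (embedParent k t X Q E u) (embed k t X Q E u) =
        (List.range (nHelpers p' + X u)).map fun i => embed k t X Q E (i :: u) := by
      intro p' hp'
      rw [embed_table hp', children, helperChildren_embed hp',
        sort_ordinaryChildren_embed hL hA hR hul' hp', List.range_add, List.map_append,
        List.map_map, List.map_map]
      congr 1
      refine List.map_congr_left fun j hj => ?_
      exact (embed_ordinary (nodeInfo_cons_ordinary.2 ⟨rfl, p', hp', by omega,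
        by simpa using hj⟩)).symm
    cases a with
    | helper =>
      obtain ⟨-, p', h1, h2⟩ := nodeInfo_cons_helper.1 hpa
      rw [hch p' h1]
      exact key _ (by omega)
    | ordinary =>
      obtain ⟨-, p', h1, h2, h3⟩ := nodeInfo_cons_ordinary.1 hpa
      rw [hch p' h1]
      exact key _ h3
    | table =>
      rcases nodeInfo_cons_table.1 hpa with ⟨-, p', h1, h2⟩ | ⟨-, p', h1, h2⟩
      · rw [children_embed_helper h1]
        exact key _ h2
      · rw [children_embed_ordinary hL hA hR hul'.le h1]
        exact key _ h2

theorem offspring_embed (hL : EndsWithTables k L t X) (hA : Admissible k t X L Q E)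
    (hR : Realizes k t X L Q E W s) {u : List ℕ} (hu : u ∈ tables (k + 1) L t X) :
    offspring s (embed k t X Q E []) u = X u := by
  obtain ⟨hul, p, hp⟩ := (mem_tables _ _ _).1 hu
  have h := sort_ordinaryChildren_embed hL hA hR hul hp
  rw [offspring, walk_embed hL hA hR hul.le (by simp [hp]), embed_table hp]
  simpa using congrArg List.length h

/-- Since the offspring numbers of the graph agree with `X` on the relevant tables, every walk of
length at most `L` has an address in the prescribed tree; there the endpoints are distinct by
admissibility. -/
theorem walkInjective_embed (hL : EndsWithTables k L t X) (hA : Admissible k t X L Q E)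
    (hR : Realizes k t X L Q E W s) : WalkInjective s (embed k t X Q E []) L := by
  have hsome : ∀ u p, u.length ≤ L → walk s (embed k t X Q E []) u = some p →
      (nodeInfo (k + 1) t X u).isSome := by
    intro u p hu hp
    rw [← nodeInfo_congr (fun v hv => offspring_embed hL hA hR hv) hu]
    have := nodeInfo_offspring s (embed k t X Q E []) u
    rw [gType_embed (p := none) (a := t) rfl, hp] at this
    simp [this]
  intro u v p q hu hv hp hq hpq
  have hu' := hsome u p hu hp
  have hv' := hsome v q hv hq
  rw [walk_embed hL hA hR hu hu'] at hp
  rw [walk_embed hL hA hR hv hv'] at hq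
  refine hA.injective u v hu hv hu' hv' ?_
  rw [← Option.some.inj hp, ← Option.some.inj hq] at hpq
  exact hpq

end Embedding

/-! ### Counting lemmas -/

section Counting

/-- Greedy choice: each new value has to avoid at most `B` elements for each value chosen before. -/
theorem card_separated_fin {α : Type*} [Fintype α] (r : α → α → Prop) [DecidableRel r] (B : ℕ)
    (hr : ∀ a b, r a b → r b a) (hB : ∀ b, (Finset.univ.filter fun a => r a b).card ≤ B) (K : ℕ) :
    (Fintype.card α - K * B) ^ K ≤
      (Finset.univ.filter fun f : Fin K → α => ∀ i j, i ≠ j → ¬ r (f i) (f j)).card := by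
  classical
  induction K with
  | zero => simp
  | succ K ih =>
    set S := Finset.univ.filter fun f : Fin K → α => ∀ i j, i ≠ j → ¬ r (f i) (f j) with hS
    let T : (Fin K → α) → Finset α := fun f => Finset.univ.filter fun a => ∀ j, ¬ r a (f j)
    have hT : ∀ f, Fintype.card α - (K + 1) * B ≤ (T f).card := by
      intro f
      have h1 : Finset.univ ⊆ T f ∪ Finset.univ.biUnion
          fun j => Finset.univ.filter fun a => r a (f j) := by
        intro a _
        by_cases h : ∀ j, ¬ r a (f j)
        · exact Finset.mem_union_left _ (by simp [T, h])
        · push Not at h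
          obtain ⟨j, hj⟩ := h
          exact Finset.mem_union_right _ (by simp only [Finset.mem_biUnion]; exact ⟨j, by simp [hj]⟩)
      have h2 := (Finset.card_le_card h1).trans (Finset.card_union_le _ _)
      have h3 : (Finset.univ.biUnion
          fun j => Finset.univ.filter fun a => r a (f j)).card ≤ K * B := by
        refine (Finset.card_biUnion_le_card_mul _ _ B fun j _ => hB (f j)).trans ?_
        simp
      rw [Finset.card_univ] at h2
      have : K * B ≤ (K + 1) * B := Nat.mul_le_mul_right _ (by omega)
      omega
    calc (Fintype.card α - (K + 1) * B) ^ (K + 1)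
        = (Fintype.card α - (K + 1) * B) ^ K * (Fintype.card α - (K + 1) * B) := pow_succ _ _
      _ ≤ S.card * (Fintype.card α - (K + 1) * B) := by
          refine Nat.mul_le_mul_right _ (le_trans ?_ ih)
          refine Nat.pow_le_pow_left (Nat.sub_le_sub_left (Nat.mul_le_mul_right _ ?_) _) _
          omega
      _ ≤ ∑ f ∈ S, (T f).card := by
          rw [← smul_eq_mul]
          exact Finset.card_nsmul_le_sum _ _ _ fun f _ => hT f
      _ = (S.sigma T).card := (Finset.card_sigma _ _).symm
      _ ≤ _ := by
          refine Finset.card_le_card_of_injOn (fun x => Fin.cons x.2 x.1) ?_ ?_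
          · rintro ⟨f, a⟩ hfa
            simp only [Finset.coe_sigma, Set.mem_sigma_iff, Finset.mem_coe, hS, T,
              Finset.mem_filter, Finset.mem_univ, true_and] at hfa
            simp only [Finset.coe_filter, Finset.mem_univ, true_and, Set.mem_ofPred_eq]
            intro i j
            refine Fin.cases ?_ (fun i => ?_) i <;> refine Fin.cases ?_ (fun j => ?_) j
            · simp
            · intro _
              simpa using hfa.2 j
            · intro _ h
              exact hfa.2 i (hr _ _ (by simpa using h))
            · intro hij
              simpa using hfa.1 i j (by simpa using hij)
          · rintro ⟨f, a⟩ - ⟨g, b⟩ - h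
            obtain ⟨rfl, rfl⟩ := Fin.cons_injective2 h
            rfl

theorem card_separated {α ι : Type*} [Fintype α] [Fintype ι] [DecidableEq ι] (r : α → α → Prop)
    [DecidableRel r] (B : ℕ)
    (hr : ∀ a b, r a b → r b a) (hB : ∀ b, (Finset.univ.filter fun a => r a b).card ≤ B) :
    (Fintype.card α - Fintype.card ι * B) ^ Fintype.card ι ≤
      (Finset.univ.filter fun f : ι → α => ∀ i j, i ≠ j → ¬ r (f i) (f j)).card := by
  refine (card_separated_fin r B hr hB (Fintype.card ι)).trans ?_
  let e := Fintype.equivFin ι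
  refine Finset.card_le_card_of_injOn (fun f => f ∘ e) ?_ ?_
  · intro f hf
    simp only [Finset.coe_filter, Finset.mem_univ, true_and, Set.mem_ofPred_eq] at hf ⊢
    intro i j hij
    exact hf _ _ (by simpa using hij)
  · intro f _ g _ h
    exact e.surjective.injective_comp_right h

/-- Sort the values of `f` separately within each fibre of `π`. -/
theorem exists_perm_strictMonoOn_fibers {ι κ : Type*} [Fintype ι] [LinearOrder ι] (π : ι → κ)
    {M : Type*} [LinearOrder M] (f : ι → M) (hf : Function.Injective f) :
    ∃ σ : Equiv.Perm ι, π ∘ σ = π ∧ ∀ i j, π i = π j → i < j → f (σ i) < f (σ j) := by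
  classical
  have h : ∀ x : κ, ∃ σ : Equiv.Perm {i // π i = x}, StrictMono fun i => f (σ i) := by
    intro x
    let o := Fintype.orderIsoFinOfCardEq {i // π i = x} rfl
    let g : Fin (Fintype.card {i // π i = x}) → M := fun i => f (o i)
    refine ⟨(o.symm.toEquiv.trans (Tuple.sort g)).trans o.toEquiv, ?_⟩
    have h1 : StrictMono (g ∘ Tuple.sort g) := by
      refine (Tuple.monotone_sort g).strictMono_of_injective ?_
      exact (hf.comp (Subtype.val_injective.comp o.injective)).comp (Tuple.sort g).injective
    exact h1.comp o.symm.strictMono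
  choose τ hτ using h
  refine ⟨(Equiv.sigmaFiberEquiv π).permCongr (Equiv.Perm.sigmaCongrRight τ), ?_, ?_⟩
  · ext i
    exact (τ (π i) ⟨i, rfl⟩).2
  · intro i j hij hlt
    have key : ∀ x (hi : π i = x), ((Equiv.sigmaFiberEquiv π).permCongr
        (Equiv.Perm.sigmaCongrRight τ)) i = τ x ⟨i, hi⟩ := by
      rintro x rfl
      rfl
    have key' : ∀ x (hi : π j = x), ((Equiv.sigmaFiberEquiv π).permCongr
        (Equiv.Perm.sigmaCongrRight τ)) j = τ x ⟨j, hi⟩ := by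
      rintro x rfl
      rfl
    rw [key (π j) hij, key' (π j) rfl]
    exact hτ (π j) hlt

/-- Every injection is one that increases on fibres, composed with a permutation preserving the
fibres. The latter form the stabilizer of `π`, whose order is the product of factorials; these
become the denominators of the Poisson weights. -/
theorem descFactorial_le_card_increasing {ι κ : Type*} [Fintype ι] [LinearOrder ι] [Fintype κ]
    [DecidableEq κ] (π : ι → κ) (m : ℕ) :
    m.descFactorial (Fintype.card ι) ≤
      (Finset.univ.filter fun f : ι → Fin m => Function.Injective f ∧
        ∀ i j, π i = π j → i < j → f i < f j).card *
      ∏ x, (Finset.univ.filter fun i => π i = x).card.factorial := by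
  classical
  have h1 : m.descFactorial (Fintype.card ι) =
      (Finset.univ.filter fun f : ι → Fin m => Function.Injective f).card := by
    have := Fintype.card_embedding_eq (α := ι) (β := Fin m)
    rw [Fintype.card_fin] at this
    rw [← this, ← Fintype.card_subtype]
    exact Fintype.card_congr (Equiv.subtypeInjectiveEquivEmbedding ι (Fin m)).symm
  have h2 : ∏ x, (Finset.univ.filter fun i => π i = x).card.factorial =
      (Finset.univ.filter fun σ : Equiv.Perm ι => π ∘ σ = π).card := by
    rw [← Fintype.card_subtype, DomMulAct.stabilizer_card]
    simp only [Fintype.card_subtype]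
  rw [h1, h2, ← Finset.card_product]
  refine Finset.card_le_card_of_surjOn (fun x => x.1 ∘ x.2) ?_
  intro f hf
  simp only [Finset.coe_filter, Finset.mem_univ, true_and, Set.mem_ofPred_eq] at hf
  obtain ⟨σ, hσ, hmono⟩ := exists_perm_strictMonoOn_fibers π f hf
  refine ⟨(f ∘ σ, σ.symm), ?_, ?_⟩
  · simp only [Finset.coe_product, Finset.coe_filter, Finset.mem_univ, true_and, Set.mem_prod,
      Set.mem_ofPred_eq]
    refine ⟨⟨hf.comp σ.injective, hmono⟩, ?_⟩
    rw [Equiv.comp_symm_eq]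
    exact hσ.symm
  · ext i
    simp

end Counting

/-! ### Ordinary edges and clusters of the truncated tree -/

section TreeCounts

variable (k L : ℕ) (t : VType) (X : List ℕ → ℕ)

open Classical in
/-- The vertices of type `A_R` at depth at most `L`. -/
noncomputable def ordinaries : Finset (List ℕ) :=
  (finite_nodes (k + 1) L t X).toFinset.filter
    fun u => ∃ p, nodeInfo (k + 1) t X u = some (p, .ordinary)

open Classical in
/-- The heads of the clusters at depth at most `L`. -/
noncomputable def heads : Finset (List ℕ) :=
  (finite_nodes (k + 1) L t X).toFinset.filter
    fun u => (frame k t X u).1 = u ∧ ∃ p a, nodeInfo (k + 1) t X u = some (p, a) ∧ a ≠ .ordinary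

variable {k L t X}

theorem mem_ordinaries {u : List ℕ} : u ∈ ordinaries k L t X ↔
    u.length ≤ L ∧ ∃ p, nodeInfo (k + 1) t X u = some (p, .ordinary) := by
  simp only [ordinaries, Finset.mem_filter, Set.Finite.mem_toFinset, Set.mem_ofPred_eq]
  constructor
  · rintro ⟨⟨h1, -⟩, h2⟩
    exact ⟨h1, h2⟩
  · rintro ⟨h1, p, hp⟩
    exact ⟨⟨h1, by simp [hp]⟩, p, hp⟩

theorem mem_heads {u : List ℕ} : u ∈ heads k L t X ↔
    u.length ≤ L ∧ (frame k t X u).1 = u ∧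
      ∃ p a, nodeInfo (k + 1) t X u = some (p, a) ∧ a ≠ .ordinary := by
  simp only [heads, Finset.mem_filter, Set.Finite.mem_toFinset, Set.mem_ofPred_eq]
  constructor
  · rintro ⟨⟨h1, -⟩, h2⟩
    exact ⟨h1, h2⟩
  · rintro ⟨h1, h2, p, a, hp, ha⟩
    exact ⟨⟨h1, by simp [hp]⟩, h2, p, a, hp, ha⟩

theorem nil_mem_ordinaries : [] ∈ ordinaries k L t X ↔ t = .ordinary := by
  simp [mem_ordinaries, nodeInfo]

theorem tail_mem_tables {u : List ℕ} (h : u ∈ ordinaries k L t X) (hu : u ≠ []) :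
    u.tail ∈ tables (k + 1) L t X := by
  obtain ⟨hl, p, hp⟩ := mem_ordinaries.1 h
  cases u with
  | nil => exact absurd rfl hu
  | cons i v =>
    obtain ⟨-, p', hv, -⟩ := nodeInfo_cons_ordinary.1 hp
    exact (mem_tables _ _ _).2 ⟨by simpa using hl, p', hv⟩

theorem card_filter_tail {v : List ℕ} (hv : v ∈ tables (k + 1) L t X) :
    ((ordinaries k L t X).filter fun u => u.tail = v).card = X v := by
  classical
  obtain ⟨hl, p, hp⟩ := (mem_tables _ _ _).1 hv
  have : (ordinaries k L t X).filter (fun u => u.tail = v) =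
      (Finset.range (X v)).image fun i => (nHelpers p + i) :: v := by
    ext u
    simp only [Finset.mem_filter, Finset.mem_image, Finset.mem_range, mem_ordinaries]
    constructor
    · rintro ⟨⟨h1, q, hq⟩, rfl⟩
      cases u with
      | nil =>
        rw [List.tail_nil] at hp
        simp [hq] at hp
      | cons i v =>
        obtain ⟨-, p', h3, h4, h5⟩ := nodeInfo_cons_ordinary.1 hq
        rw [List.tail_cons] at hp ⊢
        obtain rfl : p = p' := by simpa [hp] using h3
        exact ⟨i - nHelpers p, by omega, by rw [Nat.add_sub_cancel' h4]⟩
    · rintro ⟨i, hi, rfl⟩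
      exact ⟨⟨by simpa using hl, _, nodeInfo_cons_ordinary.2 ⟨rfl, p, hp, by omega, by omega⟩⟩, rfl⟩
  rw [this, Finset.card_image_of_injective _ (fun i j h => by simpa using h), Finset.card_range]

theorem card_ordinaries_erase :
    ((ordinaries k L t X).erase []).card = ∑ v ∈ tables (k + 1) L t X, X v := by
  classical
  rw [Finset.card_eq_sum_card_fiberwise (f := List.tail) (t := tables (k + 1) L t X)]
  · refine Finset.sum_congr rfl fun v hv => ?_
    rw [← card_filter_tail hv]
    congr 1
    ext u
    simp only [Finset.mem_filter, Finset.mem_erase]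
    refine ⟨fun h => ⟨h.1.2, h.2⟩, fun h => ⟨⟨?_, h.1⟩, h.2⟩⟩
    rintro rfl
    obtain ⟨-, p, hp⟩ := mem_ordinaries.1 h.1
    obtain ⟨-, q, hq⟩ := (mem_tables _ _ _).1 hv
    rw [← h.2, List.tail_nil] at hq
    simp [hp] at hq
  · intro u hu
    rw [Finset.mem_coe, Finset.mem_erase] at hu
    exact tail_mem_tables hu.2 hu.1

theorem prod_fiber_factorial_le (π : ordinaries k L t X → ↥(insert [] (tables (k + 1) L t X)))
    (hπ : ∀ u, (π u).1 = u.1.tail) :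
    ∏ x, (Finset.univ.filter fun i => π i = x).card.factorial ≤
      ∏ v ∈ tables (k + 1) L t X, (X v).factorial := by
  classical
  have h1 : ∀ x, (Finset.univ.filter fun i => π i = x).card =
      ((ordinaries k L t X).filter fun u => u.tail = x.1).card := by
    intro x
    rw [← Finset.card_map (Function.Embedding.subtype _)]
    congr 1
    ext u
    simp only [Finset.mem_map, Finset.mem_filter, Finset.mem_univ, true_and,
      Function.Embedding.subtype_apply, Subtype.exists, exists_and_right, exists_eq_right]
    constructor
    · rintro ⟨h, h'⟩
      exact ⟨h, by rw [← h', hπ]⟩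
    · rintro ⟨h, h'⟩
      exact ⟨h, Subtype.ext (by rw [hπ, h'])⟩
  simp only [h1]
  rw [Finset.prod_coe_sort (insert [] (tables (k + 1) L t X))
    fun v => ((ordinaries k L t X).filter fun u => u.tail = v).card.factorial]
  have h2 : ∏ v ∈ tables (k + 1) L t X,
      ((ordinaries k L t X).filter fun u => u.tail = v).card.factorial =
      ∏ v ∈ tables (k + 1) L t X, (X v).factorial :=
    Finset.prod_congr rfl fun v hv => by rw [card_filter_tail hv]
  by_cases h : [] ∈ tables (k + 1) L t X
  · rw [Finset.insert_eq_of_mem h, h2]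
  · rw [Finset.prod_insert h, h2]
    -- If the empty address is not a relevant table, its fibre can contain only the root itself,
    -- because `[].tail = []`; the factorial is then 1.
    have h3 : ((ordinaries k L t X).filter fun u => u.tail = []).card ≤ 1 := by
      refine Finset.card_le_one.2 ?_
      have : ∀ u ∈ (ordinaries k L t X).filter (fun u => u.tail = []), u = [] := by
        intro u hu
        rw [Finset.mem_filter] at hu
        by_contra hne
        exact h (by rw [← hu.2]; exact tail_mem_tables hu.1 hne)
      intro u hu v hv
      rw [this u hu, this v hv]
    rw [Nat.factorial_eq_one.2 h3, one_mul]

/-- The heads are the children of ordinary vertices, together with the root if it is not ordinary.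
An ordinary root has one child more than other ordinary vertices, so the count is the same in both
cases. -/
theorem card_heads (hL : EndsWithTables k L t X) :
    (heads k L t X).card = 1 + k * (ordinaries k L t X).card := by
  classical
  let C : List ℕ → Finset (List ℕ) := fun u =>
    (Finset.range (if u = [] then k + 1 else k)).image fun i => i :: u
  have h1 : heads k L t X = (if t = .ordinary then ∅ else {[]}) ∪
      (ordinaries k L t X).biUnion C := by
    ext u
    simp only [mem_heads, Finset.mem_union, Finset.mem_biUnion, C, Finset.mem_image,
      Finset.mem_range]
    constructor
    · rintro ⟨hl, hf, p, a, hp, ha⟩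
      cases u with
      | nil =>
        left
        simp only [nodeInfo, Option.some.injEq, Prod.mk.injEq] at hp
        rw [if_neg (by rw [hp.2]; exact ha)]
        simp
      | cons i v =>
        right
        have hvl : v.length ≤ L := by simp only [List.length_cons] at hl; omega
        have hlen : ∀ q b, nodeInfo (k + 1) t X v = some (q, b) → b ≠ .ordinary → False := by
          intro q b hv hb
          have h1 := (frame_spec v hv hb).1.length_le
          rw [frame_of_ne_ordinary hv hb] at hf
          simp only at hf
          have := congrArg List.length hf
          rw [List.length_cons] at this
          omega
        cases a with
        | ordinary => exact absurd rfl ha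
        | helper =>
          obtain ⟨-, q, hq, -⟩ := nodeInfo_cons_helper.1 hp
          exact (hlen _ _ hq (by simp)).elim
        | table =>
          rcases nodeInfo_cons_table.1 hp with ⟨-, q, hq, -⟩ | ⟨-, q, hq, hi⟩
          · exact (hlen _ _ hq (by simp)).elim
          · exact ⟨v, mem_ordinaries.2 ⟨hvl, q, hq⟩, i, hi, rfl⟩
    · rintro (h | ⟨v, hv, i, hi, rfl⟩)
      · split_ifs at h with ht
        · simp at h
        · rw [Finset.mem_singleton] at h
          subst h
          exact ⟨by simp, rfl, none, t, rfl, ht⟩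
      · obtain ⟨hvl, q, hq⟩ := mem_ordinaries.1 hv
        refine ⟨by simpa using hL.lt hvl hq (by simp), by rw [frame_of_ordinary hq], _, _,
          nodeInfo_cons_table.2 (.inr ⟨rfl, q, hq, hi⟩), by simp⟩
  have h2 : ((ordinaries k L t X).biUnion C).card =
      k * (ordinaries k L t X).card + if t = .ordinary then 1 else 0 := by
    rw [Finset.card_biUnion]
    · have h3 : ∀ u, (C u).card = k + if u = [] then 1 else 0 := by
        intro u
        simp only [C]
        rw [Finset.card_image_of_injective _ (fun i j h => by simpa using h), Finset.card_range]
        split_ifs <;> rfl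
      simp only [h3, Finset.sum_add_distrib, Finset.sum_const, smul_eq_mul, Finset.sum_ite_eq',
        nil_mem_ordinaries]
      ring
    · intro u _ v _ huv
      refine Finset.disjoint_left.2 fun w hu hv => huv ?_
      simp only [C, Finset.mem_image] at hu hv
      obtain ⟨i, -, rfl⟩ := hu
      obtain ⟨j, -, h⟩ := hv
      exact (List.cons.inj h).2.symm
  rw [h1, Finset.card_union_of_disjoint, h2]
  · split_ifs <;> simp; ring
  · refine Finset.disjoint_left.2 fun w hu hv => ?_
    simp only [C, Finset.mem_biUnion, Finset.mem_image] at hv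
    obtain ⟨v, -, i, -, rfl⟩ := hv
    split_ifs at hu <;> simp at hu

end TreeCounts

/-! ### Admissible placements -/

section Placement

variable {n m k L : ℕ} {t : VType} {X : List ℕ → ℕ}

/-- Two elements of `ℤ_n` are close if they differ by a small integer. -/
def Close (L : ℕ) (a b : ZMod n) : Prop := ∃ δ : ℤ, |δ| ≤ 2 * L + 2 ∧ a = b + δ

theorem Close.symm {a b : ZMod n} (h : Close L a b) : Close L b a := by
  obtain ⟨δ, h1, rfl⟩ := h
  exact ⟨-δ, by rwa [abs_neg], by push_cast; ring⟩

open Classical in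
theorem card_close_le [NeZero n] (b : ZMod n) :
    (Finset.univ.filter fun a => Close L a b).card ≤ 4 * L + 5 := by
  have : (Finset.univ.filter fun a => Close L a b) ⊆
      (Finset.Icc (-(2 * L + 2 : ℤ)) (2 * L + 2)).image fun δ : ℤ => b + (δ : ZMod n) := by
    intro a ha
    simp only [Finset.mem_filter, Finset.mem_univ, true_and] at ha
    obtain ⟨δ, h1, rfl⟩ := ha
    exact Finset.mem_image.2 ⟨δ, Finset.mem_Icc.2 (abs_le.1 h1), rfl⟩
  refine (Finset.card_le_card this).trans (Finset.card_image_le.trans ?_)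
  rw [Int.card_Icc]
  omega

/-- The head has coordinate 0 or 1 and there are at most `L` steps. Two offsets thus differ by at
most `2 * L + 2`, the radius used in `Close`. -/
theorem abs_frame_div_two_le {u : List ℕ} {p : Option VType} {a : VType}
    (hu : nodeInfo (k + 1) t X u = some (p, a)) (ha : a ≠ .ordinary) (hl : u.length ≤ L) :
    |(frame k t X u).2.1 / 2| ≤ L + 1 := by
  obtain ⟨g1, -, g3, g4, -, -, -, -, g9, g10⟩ := frame_spec u hu ha
  have := g1.length_le
  have h : |(frame k t X u).2.1| ≤ L + 1 := by
    rw [g4]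
    rcases g3 with g3 | g3 | g3 <;> rw [g3] <;> rw [abs_le] <;> constructor <;> omega
  rw [abs_le] at h ⊢
  constructor <;> omega

theorem frame_fst_mem_heads {u : List ℕ} {p : Option VType} {a : VType}
    (hu : nodeInfo (k + 1) t X u = some (p, a)) (ha : a ≠ .ordinary) (hl : u.length ≤ L) :
    (frame k t X u).1 ∈ heads k L t X := by
  obtain ⟨g1, -, -, -, -, -, g7, g8, -⟩ := frame_spec u hu ha
  exact mem_heads.2 ⟨g1.length_le.trans hl, by rw [g8], g7⟩

/-- Far-apart heads keep different clusters disjoint, and `2 * L + 2 < n` prevents a single cluster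
from wrapping around `ℤ_n`. Halving loses nothing, because the type fixes the parity of the
coordinate. -/
theorem admissible_of (hn : 2 * L + 2 < n) {Q : List ℕ → ZMod n} {E : List ℕ → Fin m}
    (hQ : ∀ a ∈ heads k L t X, ∀ b ∈ heads k L t X, a ≠ b → ¬ Close L (Q a) (Q b))
    (hE : ∀ a ∈ ordinaries k L t X, ∀ b ∈ ordinaries k L t X, E a = E b → a = b)
    (hE' : ∀ a ∈ ordinaries k L t X, ∀ b ∈ ordinaries k L t X, a.tail = b.tail → a < b →
      E a < E b) : Admissible k t X L Q E := by
  have hpos : ∀ {u v p q a}, nodeInfo (k + 1) t X u = some (p, a) →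
      nodeInfo (k + 1) t X v = some (q, a) → a ≠ .ordinary → u.length ≤ L → v.length ≤ L →
      pos k t X Q u = pos k t X Q v → u = v := by
    intro u v p q a hu hv ha hul hvl h
    have hu1 := abs_le.1 (abs_frame_div_two_le hu ha hul)
    have hv1 := abs_le.1 (abs_frame_div_two_le hv ha hvl)
    have hhead : (frame k t X u).1 = (frame k t X v).1 := by
      by_contra hne
      refine hQ _ (frame_fst_mem_heads hu ha hul) _ (frame_fst_mem_heads hv ha hvl) hne
        ⟨(frame k t X v).2.1 / 2 - (frame k t X u).2.1 / 2, abs_le.2 (by constructor <;> omega), ?_⟩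
      rw [pos, pos] at h
      rw [Int.cast_sub, add_sub, ← h]
      ring
    refine frame_injective hu ha hv ha hhead ?_
    rw [pos, pos, hhead, add_right_inj, ← sub_eq_zero, ← Int.cast_sub,
      ZMod.intCast_zmod_eq_zero_iff_dvd] at h
    have h0 : (frame k t X u).2.1 / 2 - (frame k t X v).2.1 / 2 = 0 := by
      refine Int.eq_zero_of_abs_lt_dvd h (abs_lt.2 ?_)
      constructor <;> omega
    obtain ⟨-, -, -, -, g5, g6, -⟩ := frame_spec u hu ha
    obtain ⟨-, -, -, -, k5, k6, -⟩ := frame_spec v hv ha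
    cases a with
    | ordinary => exact absurd rfl ha
    | helper =>
      have := g6 rfl
      have := k6 rfl
      omega
    | table =>
      have := g5 rfl
      have := k5 rfl
      omega
  refine ⟨fun u v hul hvl hu hv h => ?_, fun i j u p q hl hij hi hj => ?_⟩
  · obtain ⟨⟨p, a⟩, hu⟩ := Option.isSome_iff_exists.1 hu
    obtain ⟨⟨q, b⟩, hv⟩ := Option.isSome_iff_exists.1 hv
    obtain rfl : a = b := by rw [← gType_embed hu, h, gType_embed hv]
    cases a with
    | ordinary =>
      rw [embed_ordinary hu, embed_ordinary hv] at h
      exact hE u (mem_ordinaries.2 ⟨hul, p, hu⟩) v (mem_ordinaries.2 ⟨hvl, q, hv⟩) (by simpa using h)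
    | helper =>
      rw [embed_helper hu, embed_helper hv] at h
      exact hpos hu hv (by simp) hul hvl (by simpa using h)
    | table =>
      rw [embed_table hu, embed_table hv] at h
      exact hpos hu hv (by simp) hul hvl (by simpa using h)
  · exact hE' _ (mem_ordinaries.2 ⟨by simpa using hl, p, hi⟩) _
      (mem_ordinaries.2 ⟨by simpa using hl, q, hj⟩) rfl (by simpa [List.cons_lt_cons_iff] using hij)

/-- The placement can be recovered by walking from the root in `s`: this yields the positions of the
heads and the names of the ordinary edges. -/
theorem placement_unique (hL : EndsWithTables k L t X) {Q Q' : List ℕ → ZMod n}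
    {E E' : List ℕ → Fin m} {W W' : List ℕ → Fin (k + 1)} {s : Fin m → Fin (k + 1) → ZMod n}
    (hA : Admissible k t X L Q E) (hA' : Admissible k t X L Q' E')
    (hR : Realizes k t X L Q E W s) (hR' : Realizes k t X L Q' E' W' s)
    (h0 : embed k t X Q E [] = embed k t X Q' E' []) :
    (∀ u ∈ heads k L t X, Q u = Q' u) ∧ (∀ u ∈ ordinaries k L t X, E u = E' u) ∧
      ∀ u ∈ (ordinaries k L t X).erase [], W u = W' u := by
  have hembed : ∀ {u p a}, u.length ≤ L → nodeInfo (k + 1) t X u = some (p, a) →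
      embed k t X Q E u = embed k t X Q' E' u := by
    intro u p a hul hu
    have h1 := walk_embed hL hA hR hul (by simp [hu])
    have h2 := walk_embed hL hA' hR' hul (by simp [hu])
    rw [h0, h2] at h1
    exact (congrArg Prod.snd (Option.some.inj h1)).symm
  have hE : ∀ u ∈ ordinaries k L t X, E u = E' u := by
    intro u hu
    obtain ⟨hul, p, hp⟩ := mem_ordinaries.1 hu
    have := hembed hul hp
    rw [embed_ordinary hp, embed_ordinary hp] at this
    simpa using this
  refine ⟨fun u hu => ?_, hE, fun u hu => ?_⟩
  · obtain ⟨hul, hf, p, a, hp, ha⟩ := mem_heads.1 hu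
    have hz : (frame k t X u).2.1 / 2 = 0 := by
      obtain ⟨-, -, -, -, -, -, -, -, g9, g10⟩ := frame_spec u hp ha
      rw [hf] at g9 g10
      omega
    have h1 : ∀ R : List ℕ → ZMod n, pos k t X R u = R u := by
      intro R
      rw [pos, hz, hf]
      simp
    have := hembed hul hp
    cases a with
    | ordinary => exact absurd rfl ha
    | helper =>
      rw [embed_helper hp, embed_helper hp, h1, h1] at this
      simpa using this
    | table =>
      rw [embed_table hp, embed_table hp, h1, h1] at this
      simpa using this
  · obtain ⟨hne, hu⟩ := Finset.mem_erase.1 hu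
    obtain ⟨hul, p, hp⟩ := mem_ordinaries.1 hu
    have hrow := (hR.row_eq u p hul hp).symm.trans ((congrArg s (hE u hu)).trans
      (hR'.row_eq u p hul hp))
    cases u with
    | nil => exact absurd rfl hne
    | cons i v =>
      by_contra hW
      obtain ⟨-, p', hv, -⟩ := nodeInfo_cons_ordinary.1 hp
      have hvl : v.length ≤ L := by simp only [List.length_cons] at hul; omega
      have hpv : pos k t X Q v = pos k t X Q' v := by
        have := hembed hvl hv
        rw [embed_table hv, embed_table hv] at this
        simpa using this
      -- If the parent slots differed, the slot `W` would hold the parent in one placement and a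
      -- child in the other, so a child would be placed on its grandparent.
      obtain ⟨j, hj⟩ := Fin.exists_succAbove_eq hW
      have := congrFun hrow (W (i :: v))
      rw [row, Fin.insertNth_apply_same, row, hpv, ← hj, Fin.insertNth_apply_succAbove,
        ← pos_of_ordinary (Q := Q') hp] at this
      have := hA'.eq_of_pos_eq hvl (by simpa using hL.lt hul hp (by simp)) hv
        (nodeInfo_cons_table.2 (.inr ⟨rfl, p, hp, by simp⟩)) this
      have := congrArg List.length this
      simp only [List.length_cons] at this
      omega

-- The conditions decouple over the ordinary edges: the rows named by `E` are forced, and the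
-- entries of all other rows range freely over the complement of the table positions.
open Classical in
theorem card_realizes [NeZero n] {Q : List ℕ → ZMod n} {E : List ℕ → Fin m}
    {W : List ℕ → Fin (k + 1)}
    (hE : ∀ a ∈ ordinaries k L t X, ∀ b ∈ ordinaries k L t X, E a = E b → a = b) :
    (n - (tables (k + 1) L t X).card) ^ ((k + 1) * (m - (ordinaries k L t X).card)) ≤
      (Finset.univ.filter fun s => Realizes k t X L Q E W s).card := by
  let D : Finset (ZMod n) := ((tables (k + 1) L t X).image (pos k t X Q))ᶜ
  have hD : n - (tables (k + 1) L t X).card ≤ D.card := by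
    rw [Finset.card_compl, ZMod.card]
    exact Nat.sub_le_sub_left Finset.card_image_le _
  let R : Fin m → Finset (Fin (k + 1) → ZMod n) := fun e =>
    if h : ∃ u ∈ ordinaries k L t X, E u = e then {row k t X Q W h.choose}
    else Fintype.piFinset fun _ => D
  have hsub : Fintype.piFinset R ⊆ Finset.univ.filter fun s => Realizes k t X L Q E W s := by
    intro s hs
    rw [Fintype.mem_piFinset] at hs
    refine Finset.mem_filter.2 ⟨Finset.mem_univ _, ⟨fun u p hul hp => ?_, fun e he j u hu => ?_⟩⟩
    · have hu := mem_ordinaries.2 ⟨hul, p, hp⟩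
      have h : ∃ v ∈ ordinaries k L t X, E v = E u := ⟨u, hu, rfl⟩
      have h1 := hs (E u)
      simp only [R, dif_pos h, Finset.mem_singleton] at h1
      rw [h1, hE _ h.choose_spec.1 _ hu h.choose_spec.2]
    · have h : ¬ ∃ v ∈ ordinaries k L t X, E v = e := by
        rintro ⟨v, hv, hve⟩
        obtain ⟨hvl, p, hp⟩ := mem_ordinaries.1 hv
        exact he v p hvl hp hve
      have h1 := hs e
      simp only [R, dif_neg h, Fintype.mem_piFinset] at h1
      have h2 := h1 j
      simp only [D, Finset.mem_compl, Finset.mem_image, not_exists, not_and] at h2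
      exact fun h3 => h2 u hu h3.symm
  refine le_trans ?_ (Finset.card_le_card hsub)
  rw [Fintype.card_piFinset]
  have hcard : ∀ e, (R e).card = if e ∈ (ordinaries k L t X).image E then 1 else D.card ^ (k + 1) := by
    intro e
    simp only [Finset.mem_image, R]
    split_ifs with h <;> simp
  simp only [hcard]
  rw [Finset.prod_ite, Finset.prod_const_one, one_mul, Finset.prod_const, ← pow_mul]
  have hm : (Finset.univ.filter fun e => e ∉ (ordinaries k L t X).image E).card =
      m - (ordinaries k L t X).card := by
    rw [← Finset.card_image_of_injOn (s := ordinaries k L t X) (f := E)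
      (fun a ha b hb h => hE a ha b hb h)]
    have : (Finset.univ.filter fun e => e ∉ (ordinaries k L t X).image E) =
        ((ordinaries k L t X).image E)ᶜ := by
      ext e
      simp
    rw [this, Finset.card_compl, Fintype.card_fin]
  rw [hm]
  exact Nat.pow_le_pow_left hD _

end Placement

/-! ### The number of outcomes with a prescribed unfolding -/

section Matching

variable {n m k : ℕ}

/-- The unfolding has no collisions up to depth `L`, and its truncation is given by `t` and `X`. -/
def Matches (L : ℕ) (t : VType) (X : List ℕ → ℕ)
    (ω : (Fin m → Fin (k + 1) → ZMod n) × GVertex n m) : Prop :=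
  WalkInjective ω.1 ω.2 L ∧ gType ω.2 = t ∧
    ∀ u ∈ tables (k + 1) L t X, offspring ω.1 ω.2 u = X u

/-- The extension of a function on a finite set of addresses by a default value. -/
def extend {α : Type*} (S : Finset (List ℕ)) (d : α) (f : S → α) (u : List ℕ) : α :=
  if h : u ∈ S then f ⟨u, h⟩ else d

theorem extend_apply {α : Type*} {S : Finset (List ℕ)} {d : α} {f : S → α} {u : List ℕ}
    (h : u ∈ S) : extend S d f u = f ⟨u, h⟩ := dif_pos h

theorem extend_congr {α : Type*} {S : Finset (List ℕ)} {d : α} {f g : S → α}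
    (h : ∀ u ∈ S, extend S d f u = extend S d g u) : f = g := by
  ext ⟨u, hu⟩
  simpa only [extend_apply hu] using h u hu

variable {L : ℕ} {t : VType} {X : List ℕ → ℕ}

-- The pairs of a placement and an outcome realizing it inject into the matching outcomes by
-- `placement_unique`. The factorials are on the right since they are the number of orderings lost
-- by naming siblings increasingly.
open Classical in
theorem le_card_matches [NeZero n] [NeZero m] (hL : EndsWithTables k L t X) (hn : 2 * L + 2 < n) :
    (n - (heads k L t X).card * (4 * L + 5)) ^ (heads k L t X).card *
        m.descFactorial (ordinaries k L t X).card *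
        (k + 1) ^ ((ordinaries k L t X).erase []).card *
        (n - (tables (k + 1) L t X).card) ^ ((k + 1) * (m - (ordinaries k L t X).card)) ≤
      (Finset.univ.filter fun ω : (Fin m → Fin (k + 1) → ZMod n) × GVertex n m =>
        Matches L t X ω).card * ∏ v ∈ tables (k + 1) L t X, (X v).factorial := by
  set Cl := heads k L t X
  set O := ordinaries k L t X
  set I := tables (k + 1) L t X
  let π : O → ↥(insert [] I) := fun u => ⟨u.1.tail, by
    by_cases h : u.1 = []
    · simp [h]
    · exact Finset.mem_insert_of_mem (tail_mem_tables u.2 h)⟩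
  let S₁ : Finset (Cl → ZMod n) :=
    Finset.univ.filter fun q => ∀ a b, a ≠ b → ¬ Close L (q a) (q b)
  let S₂ : Finset (O → Fin m) := Finset.univ.filter fun e => Function.Injective e ∧
    ∀ a b, π a = π b → a < b → e a < e b
  let S₃ : Finset (↥(O.erase []) → Fin (k + 1)) := Finset.univ
  have h1 : (n - Cl.card * (4 * L + 5)) ^ Cl.card ≤ S₁.card := by
    have := card_separated (ι := Cl) (fun a b : ZMod n => Close L a b) (4 * L + 5)
      (fun _ _ => Close.symm) card_close_le
    rw [ZMod.card, Fintype.card_coe] at this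
    convert this
  have h2 : m.descFactorial O.card ≤ S₂.card * ∏ v ∈ I, (X v).factorial := by
    have h := descFactorial_le_card_increasing π m
    rw [Fintype.card_coe] at h
    have h' := h.trans (Nat.mul_le_mul_left _ (prod_fiber_factorial_le π fun _ => rfl))
    refine h'.trans (Nat.mul_le_mul_right _ (le_of_eq ?_))
    congr!
  have h3 : S₃.card = (k + 1) ^ (O.erase []).card := by
    simp [S₃]
  let Q : (Cl → ZMod n) → List ℕ → ZMod n := extend Cl 0
  let E : (O → Fin m) → List ℕ → Fin m := extend O 0
  let W : (↥(O.erase []) → Fin (k + 1)) → List ℕ → Fin (k + 1) := extend (O.erase []) 0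
  let S := S₁ ×ˢ S₂ ×ˢ S₃
  have hEinj : ∀ x ∈ S, ∀ a ∈ O, ∀ b ∈ O, E x.2.1 a = E x.2.1 b → a = b := by
    rintro ⟨q, e, w⟩ hx a ha b hb h
    simp only [S, S₂, Finset.mem_product, Finset.mem_filter] at hx
    simp only [E, extend_apply ha, extend_apply hb] at h
    simpa using hx.2.1.2.1 h
  have hAdm : ∀ x ∈ S, Admissible k t X L (Q x.1) (E x.2.1) := by
    intro x hx
    refine admissible_of hn ?_ (hEinj x hx) ?_
    · intro a ha b hb hab
      rcases x with ⟨q, e, w⟩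
      simp only [S, S₁, Finset.mem_product, Finset.mem_filter] at hx
      simp only [Q]
      rw [extend_apply ha, extend_apply hb]
      exact hx.1.2 _ _ (by simpa using hab)
    · intro a ha b hb hab hlt
      rcases x with ⟨q, e, w⟩
      simp only [S, S₂, Finset.mem_product, Finset.mem_filter] at hx
      simp only [E]
      rw [extend_apply ha, extend_apply hb]
      exact hx.2.1.2.2 _ _ (Subtype.ext hab) hlt
  let A : (Cl → ZMod n) × (O → Fin m) × (↥(O.erase []) → Fin (k + 1)) →
      Finset (Fin m → Fin (k + 1) → ZMod n) := fun x =>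
    Finset.univ.filter fun s => Realizes k t X L (Q x.1) (E x.2.1) (W x.2.2) s
  have h4 : S.card * (n - I.card) ^ ((k + 1) * (m - O.card)) ≤
      (Finset.univ.filter fun ω : (Fin m → Fin (k + 1) → ZMod n) × GVertex n m =>
        Matches L t X ω).card := by
    calc S.card * (n - I.card) ^ ((k + 1) * (m - O.card)) ≤ ∑ x ∈ S, (A x).card := by
          rw [← smul_eq_mul]
          exact Finset.card_nsmul_le_sum _ _ _ fun x hx => card_realizes (hEinj x hx)
      _ = (S.sigma A).card := (Finset.card_sigma _ _).symm
      _ ≤ _ := by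
        refine Finset.card_le_card_of_injOn
          (fun y => (y.2, embed k t X (Q y.1.1) (E y.1.2.1) [])) ?_ ?_
        · rintro ⟨x, s⟩ hxs
          rw [Finset.mem_coe, Finset.mem_sigma] at hxs
          have hR := (Finset.mem_filter.1 hxs.2).2
          have hA := hAdm x hxs.1
          exact Finset.mem_coe.2 (Finset.mem_filter.2 ⟨Finset.mem_univ _,
            walkInjective_embed hL hA hR, gType_embed (p := none) rfl,
            fun u hu => offspring_embed hL hA hR hu⟩)
        · rintro ⟨x, s⟩ hxs ⟨x', s'⟩ hxs' h
          rw [Finset.mem_coe, Finset.mem_sigma] at hxs hxs'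
          simp only [Prod.mk.injEq] at h
          obtain ⟨rfl, h0⟩ := h
          obtain ⟨g1, g2, g3⟩ := placement_unique hL (hAdm x hxs.1) (hAdm x' hxs'.1)
            (Finset.mem_filter.1 hxs.2).2 (Finset.mem_filter.1 hxs'.2).2 h0
          obtain rfl : x = x' :=
            Prod.ext (extend_congr g1) (Prod.ext (extend_congr g2) (extend_congr g3))
          rfl
  have hS : S.card = S₁.card * (S₂.card * S₃.card) := by
    simp only [S, Finset.card_product]
  calc _ ≤ S₁.card * (S₂.card * ∏ v ∈ I, (X v).factorial) * S₃.card *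
        (n - I.card) ^ ((k + 1) * (m - O.card)) := by
        rw [h3]
        gcongr
    _ = (S.card * (n - I.card) ^ ((k + 1) * (m - O.card))) * ∏ v ∈ I, (X v).factorial := by
        rw [hS]
        ring
    _ ≤ _ := Nat.mul_le_mul_right _ h4

end Matching

/-! ### Asymptotics -/

section Asymptotics

theorem tendsto_natSub_div (m : ℕ → ℕ) (c : ℝ) (hc : 0 < c)
    (hm : Tendsto (fun n : ℕ => (m n : ℝ) / (n : ℝ)) atTop (𝓝 c)) :
    Tendsto m atTop atTop ∧
      ∀ a : ℕ, Tendsto (fun n : ℕ => ((m n - a : ℕ) : ℝ) / n) atTop (𝓝 c) := by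
  have h1 : Tendsto m atTop atTop := by
    rw [← tendsto_natCast_atTop_iff (R := ℝ)]
    refine (hm.pos_mul_atTop hc tendsto_natCast_atTop_atTop).congr' ?_
    filter_upwards [eventually_gt_atTop 0] with n hn
    have : (n : ℝ) ≠ 0 := by positivity
    field_simp
  refine ⟨h1, fun a => ?_⟩
  have h2 := hm.sub (tendsto_const_div_atTop_nhds_zero_nat (a : ℝ))
  rw [sub_zero] at h2
  refine h2.congr' ?_
  filter_upwards [h1.eventually_ge_atTop a] with n hn
  rw [Nat.cast_sub hn, sub_div]

/-- This produces the exponential factors of the Poisson weights: the probability that the remaining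
ordinary edges avoid `b` given tables. -/
theorem tendsto_natSub_div_pow (b : ℕ) (N : ℕ → ℕ) (x : ℝ)
    (hN : Tendsto (fun n : ℕ => (N n : ℝ) / (n : ℝ)) atTop (𝓝 x)) :
    Tendsto (fun n : ℕ => (((n - b : ℕ) : ℝ) / n) ^ N n) atTop (𝓝 (Real.exp (-(b * x)))) := by
  have h1 : Tendsto (fun n : ℕ => (1 + -(b : ℝ) / n) ^ n) atTop (𝓝 (Real.exp (-b))) :=
    Real.tendsto_one_add_div_pow_exp _
  have h2 := h1.rpow hN (.inl (Real.exp_pos _).ne')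
  rw [← Real.exp_mul, neg_mul] at h2
  refine h2.congr' ?_
  filter_upwards [eventually_gt_atTop 0, eventually_ge_atTop b] with n hn hb
  have hn' : (n : ℝ) ≠ 0 := by positivity
  have h3 : (1 + -(b : ℝ) / n) = ((n - b : ℕ) : ℝ) / n := by
    rw [Nat.cast_sub hb]
    field_simp
    ring
  rw [h3, ← Real.rpow_natCast, ← Real.rpow_mul (by positivity), mul_div_cancel₀ _ hn',
    Real.rpow_natCast]

variable (k : ℕ) (c : ℝ≥0) (m : ℕ → ℕ)

theorem tendsto_lower_bound (hc : 0 < c)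
    (hm : Tendsto (fun n : ℕ => (m n : ℝ) / (n : ℝ)) atTop (𝓝 (c : ℝ))) (A K o b r F : ℕ)
    (hK : K = 1 + k * o) :
    Tendsto (fun n : ℕ => ((n - A : ℕ) : ℝ) ^ K * ((m n - o : ℕ) : ℝ) ^ o * (k + 1 : ℝ) ^ r *
        ((n - b : ℕ) : ℝ) ^ ((k + 1) * (m n - o)) / F /
        (((n : ℝ) ^ (k + 1)) ^ m n * (n + m n + n))) atTop
      (𝓝 ((c : ℝ) ^ o * (k + 1 : ℝ) ^ r * Real.exp (-(b * ((k + 1) * c))) / F * (1 / (2 + c)))) := by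
  obtain ⟨hinf, hsub⟩ := tendsto_natSub_div m c (by exact_mod_cast hc) hm
  have hid : Tendsto (fun n : ℕ => ((n : ℕ) : ℝ) / (n : ℝ)) atTop (𝓝 1) := by
    refine tendsto_const_nhds.congr' ?_
    filter_upwards [eventually_gt_atTop 0] with n hn
    rw [div_self (by positivity)]
  have h1 := (tendsto_natSub_div (fun n => n) 1 one_pos hid).2 A
  have h2 := hsub o
  have h3 := tendsto_natSub_div_pow b (fun n => (k + 1) * (m n - o)) ((k + 1) * c) (by
    refine (h2.const_mul ((k : ℝ) + 1)).congr fun n => ?_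
    push_cast
    ring)
  have h4 : Tendsto (fun n : ℕ => (n : ℝ) / (n + m n + n)) atTop (𝓝 (1 / (2 + c))) := by
    have : Tendsto (fun n : ℕ => 1 / (2 + (m n : ℝ) / n)) atTop (𝓝 (1 / (2 + c))) :=
      tendsto_const_nhds.div (tendsto_const_nhds.add hm) (by positivity)
    refine this.congr' ?_
    filter_upwards [eventually_gt_atTop 0] with n hn
    have : (n : ℝ) ≠ 0 := by positivity
    field_simp
    ring
  have key := ((((h1.pow K).mul (h2.pow o)).mul_const ((k + 1 : ℝ) ^ r)).mul h3).div_const (F : ℝ)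
    |>.mul h4
  rw [one_pow, one_mul] at key
  refine key.congr' ?_
  filter_upwards [eventually_gt_atTop 0, hinf.eventually_ge_atTop o] with n hn ho
  have hn' : (n : ℝ) ≠ 0 := by positivity
  -- The exponents balance because `K + o + (k + 1) * (m n - o) = (k + 1) * m n + 1`. The surplus
  -- factor `n` is paired with the number of possible roots and gives `1 / (2 + c)`.
  have hpow : ((n : ℝ) ^ (k + 1)) ^ m n * n =
      (n : ℝ) ^ K * (n : ℝ) ^ o * (n : ℝ) ^ ((k + 1) * (m n - o)) := by
    rw [← pow_mul, ← pow_succ, ← pow_add, ← pow_add, hK]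
    congr 1
    obtain ⟨j, hj⟩ := Nat.exists_eq_add_of_le ho
    rw [hj, Nat.add_sub_cancel_left]
    ring
  have hden : ((n : ℝ) + m n + n) ≠ 0 := by positivity
  rw [div_pow, div_pow, div_pow, eq_div_of_mul_eq hn' hpow]
  have h5 := pow_ne_zero K hn'
  have h6 := pow_ne_zero o hn'
  have h7 := pow_ne_zero ((k + 1) * (m n - o)) hn'
  generalize (n : ℝ) ^ K = x at *
  generalize (n : ℝ) ^ o = y at *
  generalize (n : ℝ) ^ ((k + 1) * (m n - o)) = z at *
  field_simp

end Asymptotics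

/-! ### The local limit -/

section Limit

variable {n m k : ℕ}

/-- A depth greater than `d` at which all vertices have type `B`. -/
def levelOf (d : ℕ) : VType → ℕ
  | .table => 2 * d + 2
  | _ => 2 * d + 1

theorem succ_le_levelOf (d : ℕ) (t : VType) : d + 1 ≤ levelOf d t := by
  cases t <;> simp only [levelOf] <;> omega

/-- The tree is bipartite between tables and the other types, so parity of depth decides; this is
why `levelOf` depends on the root type. -/
theorem nodeInfo_table_iff {t : VType} {X : List ℕ → ℕ} {u : List ℕ} {p : Option VType} {a : VType}
    (h : nodeInfo (k + 1) t X u = some (p, a)) :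
    a = .table ↔ (u.length % 2 = 0 ↔ t = .table) := by
  induction u generalizing p a with
  | nil =>
    simp only [nodeInfo, Option.some.injEq, Prod.mk.injEq] at h
    simp [h.2]
  | cons i u ih =>
    rw [List.length_cons]
    have hpar : (u.length + 1) % 2 = 0 ↔ ¬ u.length % 2 = 0 := by omega
    rw [hpar]
    cases a with
    | helper =>
      obtain ⟨-, p', h1, -⟩ := nodeInfo_cons_helper.1 h
      have := ih h1
      simp only [true_iff, reduceCtorEq, false_iff] at this ⊢
      tauto
    | ordinary =>
      obtain ⟨-, p', h1, -⟩ := nodeInfo_cons_ordinary.1 h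
      have := ih h1
      simp only [true_iff, reduceCtorEq, false_iff] at this ⊢
      tauto
    | table =>
      rcases nodeInfo_cons_table.1 h with ⟨-, p', h1, -⟩ | ⟨-, p', h1, -⟩ <;>
      · have := ih h1
        simp only [true_iff, reduceCtorEq, false_iff] at this ⊢
        tauto

theorem endsWithTables_levelOf (d : ℕ) (t : VType) (X : List ℕ → ℕ) :
    EndsWithTables k (levelOf d t) t X := by
  intro u p a hu h
  rw [nodeInfo_table_iff h, hu]
  cases t <;> simp [levelOf]

open Classical in
/-- The probability that the unfolding has no collisions up to the level of `y` and is given by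
`y` there. -/
noncomputable def matchProb (n m k d : ℕ) (y : VType × (List ℕ →₀ ℕ)) : ℝ :=
  if trunc (k + 1) (levelOf d y.1) y.1 y.2 = y.2 then
    (Nat.card {ω : (Fin m → Fin (k + 1) → ZMod n) × GVertex n m //
      Matches (levelOf d y.1) y.1 y.2 ω} : ℝ) /
    (Nat.card ((Fin m → Fin (k + 1) → ZMod n) × GVertex n m) : ℝ)
  else 0

theorem card_outcomes [NeZero n] :
    (Nat.card ((Fin m → Fin (k + 1) → ZMod n) × GVertex n m) : ℝ) =
      ((n : ℝ) ^ (k + 1)) ^ m * (n + m + n) := by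
  simp [Nat.card_eq_fintype_card, ZMod.card]

theorem prod_poisson {ι : Type*} (I : Finset ι) (x : ι → ℕ) (κ : ℝ) :
    ∏ u ∈ I, (Real.exp (-κ) * κ ^ x u / (x u).factorial) =
      Real.exp (-(I.card * κ)) * κ ^ (∑ u ∈ I, x u) / ((∏ u ∈ I, (x u).factorial : ℕ) : ℝ) := by
  rw [Finset.prod_div_distrib, Finset.prod_mul_distrib, Finset.prod_const,
    Finset.prod_pow_eq_pow_sum, ← Real.exp_nat_mul, Nat.cast_prod, mul_neg]

/-- An ordinary root has no Poisson parent to account for it; its missing factor `c` comes from the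
root law. -/
theorem rootProb_mul_pow (c : ℝ≥0) (L : ℕ) (t : VType) (X : List ℕ → ℕ) :
    rootProb c t * (c : ℝ) ^ ((ordinaries k L t X).erase []).card =
      (c : ℝ) ^ (ordinaries k L t X).card * (1 / (2 + c)) := by
  by_cases ht : t = .ordinary
  · rw [← Finset.card_erase_add_one (nil_mem_ordinaries (k := k) (L := L) (X := X).2 ht), pow_succ,
      ht, rootProb]
    ring
  · rw [Finset.erase_eq_of_notMem (mt nil_mem_ordinaries.1 ht)]
    have h2 : rootProb c t = 1 / (2 + c) := by
      cases t with
      | ordinary => exact absurd rfl ht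
      | _ => rfl
    rw [h2]
    ring

theorem treeLaw_real_truncEvent_eq (c : ℝ≥0) {L : VType → ℕ} {y : VType × (List ℕ →₀ ℕ)}
    (hy : trunc (k + 1) (L y.1) y.1 y.2 = y.2) :
    (treeLaw (k + 1) c).real (truncEvent (k + 1) L y) =
      (c : ℝ) ^ (ordinaries k (L y.1) y.1 y.2).card *
        (k + 1 : ℝ) ^ ((ordinaries k (L y.1) y.1 y.2).erase []).card *
        Real.exp (-((tables (k + 1) (L y.1) y.1 y.2).card * ((k + 1) * c))) /
        ((∏ v ∈ tables (k + 1) (L y.1) y.1 y.2, (y.2 v).factorial : ℕ) : ℝ) * (1 / (2 + c)) := by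
  rw [treeLaw_real_truncEvent c hy, prod_poisson, ← card_ordinaries_erase]
  have ho := rootProb_mul_pow (k := k) c (L y.1) y.1 y.2
  generalize ((ordinaries k (L y.1) y.1 y.2).erase []).card = r at *
  generalize ((∏ v ∈ tables (k + 1) (L y.1) y.1 y.2, (y.2 v).factorial : ℕ) : ℝ) = F at *
  push_cast
  rw [mul_pow]
  generalize Real.exp _ = x at *
  linear_combination (x * (k + 1 : ℝ) ^ r / F) * ho

/-- Divide the count in `le_card_matches` by the number of outcomes. If `y` is not its own
truncation, its tree event is empty and there is nothing to prove. -/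
theorem eventually_le_matchProb (d : ℕ) {c : ℝ≥0} (hc : 0 < c) {m : ℕ → ℕ}
    (hm : Tendsto (fun n : ℕ => (m n : ℝ) / (n : ℝ)) atTop (𝓝 (c : ℝ)))
    (y : VType × (List ℕ →₀ ℕ)) {x : ℝ}
    (hx : x < (treeLaw (k + 1) c).real (truncEvent (k + 1) (levelOf d) y)) :
    ∀ᶠ n in atTop, x ≤ matchProb n (m n) k d y := by
  classical
  by_cases hy : trunc (k + 1) (levelOf d y.1) y.1 y.2 = y.2
  swap
  · rw [truncEvent_eq_empty hy, measureReal_empty] at hx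
    filter_upwards with n
    rw [matchProb, if_neg hy]
    exact hx.le
  have hL := endsWithTables_levelOf (k := k) d y.1 y.2
  set L := levelOf d y.1
  set K := (heads k L y.1 y.2).card
  set o := (ordinaries k L y.1 y.2).card
  set r := ((ordinaries k L y.1 y.2).erase []).card with hr
  set b := (tables (k + 1) L y.1 y.2).card with hb
  set F := ∏ v ∈ tables (k + 1) L y.1 y.2, (y.2 v).factorial with hF
  have hlim := tendsto_lower_bound k c m hc hm (K * (4 * L + 5)) K o b r F (card_heads hL)
  have hval : (treeLaw (k + 1) c).real (truncEvent (k + 1) (levelOf d) y) =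
      (c : ℝ) ^ o * (k + 1 : ℝ) ^ r * Real.exp (-(b * ((k + 1) * c))) / F * (1 / (2 + c)) :=
    treeLaw_real_truncEvent_eq c hy
  rw [hval] at hx
  have hinf := (tendsto_natSub_div m c (by exact_mod_cast hc) hm).1
  filter_upwards [hlim.eventually (lt_mem_nhds hx), eventually_gt_atTop (2 * L + 2),
    hinf.eventually_gt_atTop 0] with n h1 h2 h3
  have : NeZero n := ⟨by omega⟩
  have : NeZero (m n) := ⟨by omega⟩
  refine h1.le.trans ?_
  rw [matchProb, if_pos hy, card_outcomes]
  refine div_le_div_of_nonneg_right ?_ (by positivity)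
  have hFpos : 0 < F := Finset.prod_pos fun v _ => Nat.factorial_pos _
  rw [div_le_iff₀ (by exact_mod_cast hFpos), Nat.card_eq_fintype_card, Fintype.card_subtype]
  have hcount := le_card_matches (n := n) (m := m n) hL h2
  have hdesc : (m n - o) ^ o ≤ (m n).descFactorial o :=
    (Nat.pow_le_pow_left (by omega) _).trans (Nat.pow_sub_le_descFactorial _ _)
  have : (n - K * (4 * L + 5)) ^ K * (m n - o) ^ o * (k + 1) ^ r *
      (n - b) ^ ((k + 1) * (m n - o)) ≤
      (Finset.univ.filter fun ω : (Fin (m n) → Fin (k + 1) → ZMod n) × GVertex n (m n) =>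
        Matches L y.1 y.2 ω).card * F := by
    refine le_trans ?_ hcount
    gcongr
  exact_mod_cast this

/-- The outcome determines `y`, so the events for different `y` are disjoint. -/
theorem Matches.eq {d : ℕ} {y : VType × (List ℕ →₀ ℕ)}
    (hy : trunc (k + 1) (levelOf d y.1) y.1 y.2 = y.2)
    {ω : (Fin m → Fin (k + 1) → ZMod n) × GVertex n m} (h : Matches (levelOf d y.1) y.1 y.2 ω) :
    y = (gType ω.2, trunc (k + 1) (levelOf d (gType ω.2)) (gType ω.2) (offspring ω.1 ω.2)) := by
  obtain ⟨-, h2, h3⟩ := h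
  refine Prod.ext h2.symm ?_
  rw [h2]
  exact ((trunc_eq_iff hy).2 h3).symm

theorem Matches.isom_ball {d : ℕ} {y : VType × (List ℕ →₀ ℕ)}
    (hy : trunc (k + 1) (levelOf d y.1) y.1 y.2 = y.2) (hn : 2 ≤ n)
    {ω : (Fin m → Fin (k + 1) → ZMod n) × GVertex n m} (h : Matches (levelOf d y.1) y.1 y.2 ω)
    (ℓ : ℕ) (a b c : Prop) :
    RootedGraph.Isom a b c ((tree (k + 1) ℓ y.1 y.2).ball d)
      ((incidenceGraph ℓ ω.1 ω.2).ball d) := by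
  have h1 := h.1
  obtain ⟨t, x⟩ := y
  obtain ⟨rfl, rfl⟩ := Prod.mk.inj (h.eq hy)
  have hd := succ_le_levelOf d (gType ω.2)
  exact (isom_ball_trunc ℓ a b c (by omega) _).symm.trans
    (isom_ball_of_walkInjective ℓ a b c hn hd h1)

theorem sum_matchProb_le [NeZero n] (d : ℕ) (F : Finset (VType × (List ℕ →₀ ℕ)))
    (R : (Fin m → Fin (k + 1) → ZMod n) × GVertex n m → Prop)
    (hR : ∀ y ∈ F, trunc (k + 1) (levelOf d y.1) y.1 y.2 = y.2 →
      ∀ ω, Matches (levelOf d y.1) y.1 y.2 ω → R ω) :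
    ∑ y ∈ F, matchProb n m k d y ≤ (Nat.card {ω // R ω} : ℝ) /
      (Nat.card ((Fin m → Fin (k + 1) → ZMod n) × GVertex n m) : ℝ) := by
  classical
  set F' := F.filter fun y => trunc (k + 1) (levelOf d y.1) y.1 y.2 = y.2 with hF'
  let M : VType × (List ℕ →₀ ℕ) → Finset ((Fin m → Fin (k + 1) → ZMod n) × GVertex n m) :=
    fun y => Finset.univ.filter fun ω => Matches (levelOf d y.1) y.1 y.2 ω
  have h1 : ∑ y ∈ F, matchProb n m k d y = ∑ y ∈ F', ((M y).card : ℝ) /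
      (Nat.card ((Fin m → Fin (k + 1) → ZMod n) × GVertex n m) : ℝ) := by
    rw [hF', Finset.sum_filter]
    refine Finset.sum_congr rfl fun y _ => ?_
    rw [matchProb, Nat.card_eq_fintype_card, Fintype.card_subtype]
  rw [h1, ← Finset.sum_div]
  refine div_le_div_of_nonneg_right ?_ (by positivity)
  rw [Nat.card_eq_fintype_card, Fintype.card_subtype, ← Nat.cast_sum, ← Finset.card_biUnion]
  · refine Nat.cast_le.2 (Finset.card_le_card fun ω hω => ?_)
    simp only [Finset.mem_biUnion, F', M, Finset.mem_filter, Finset.mem_univ, true_and] at hω ⊢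
    obtain ⟨y, hy, hω⟩ := hω
    exact hR y hy.1 hy.2 ω hω
  · intro y hy y' hy' hne
    refine Finset.disjoint_left.2 fun ω h h' => hne ?_
    rw [Finset.mem_coe, Finset.mem_filter] at hy hy'
    rw [Matches.eq hy.2 (Finset.mem_filter.1 h).2, Matches.eq hy'.2 (Finset.mem_filter.1 h').2]

end Limit

end CuckooWindows

open CuckooWindows in
theorem mainTheorem6 (k ℓ : ℕ) (hk : 2 ≤ k) (hℓ : 2 ≤ ℓ) (c : ℝ≥0) (hc : 0 < c)
    (m : ℕ → ℕ) (hm : Tendsto (fun n : ℕ => (m n : ℝ) / (n : ℝ)) atTop (𝓝 (c : ℝ)))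
    (keepMult keepType keepWeight : Prop) (d : ℕ) (H : RootedGraph) :
    Tendsto
      (fun n : ℕ => graphProb n (m n) k ℓ
        (fun R => RootedGraph.Isom keepMult keepType keepWeight (R.ball d) H))
      atTop
      (𝓝 (treeProb k ℓ c
        (fun R => RootedGraph.Isom keepMult keepType keepWeight (R.ball d) H))) := by
  -- From here on the arity is `k + 1`, and `k` counts the children of a non-root ordinary vertex.
  obtain ⟨k, rfl⟩ : ∃ j, k = j + 1 := ⟨k - 1, by omega⟩
  let S : Set (VType × (List ℕ →₀ ℕ)) := {y | RootedGraph.Isom keepMult keepType keepWeight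
    ((tree (k + 1) ℓ y.1 y.2).ball d) H}
  have hset : treeProb (k + 1) ℓ c
      (fun R => RootedGraph.Isom keepMult keepType keepWeight (R.ball d) H) =
      (treeLaw (k + 1) c).real {ω | (ω.1, trunc (k + 1) (levelOf d ω.1) ω.1 ω.2) ∈ S} := by
    rw [treeProb]
    congr 1
    ext ω
    have hd := succ_le_levelOf d ω.1
    exact (isom_ball_trunc ℓ keepMult keepType keepWeight (by omega) ω.2).congr_left H
  have hS := hasSum_truncEvent (k + 1) c (levelOf d) S
  have hSc : HasSum (Sᶜ.indicator fun y =>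
      (treeLaw (k + 1) c).real (truncEvent (k + 1) (levelOf d) y))
      (1 - (treeLaw (k + 1) c).real
        {ω | (ω.1, trunc (k + 1) (levelOf d ω.1) ω.1 ω.2) ∈ S}) := by
    have huniv := hasSum_truncEvent (k + 1) c (levelOf d) Set.univ
    rw [Set.indicator_univ] at huniv
    have h1 : (treeLaw (k + 1) c).real
        {ω | (ω.1, trunc (k + 1) (levelOf d ω.1) ω.1 ω.2) ∈ Set.univ} = 1 := by
      simp
    rw [h1] at huniv
    rw [Set.indicator_compl]
    exact huniv.sub hS
  rw [hset]
  -- The two remaining goals say that the matching events inside `S` imply the isomorphism with `H`,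
  -- and those outside `S` its negation.
  refine tendsto_of_partition hS hSc (P := fun n => matchProb n (m n) k d)
    (fun y x hx => eventually_le_matchProb d hc hm y hx) ?_ ?_
  · filter_upwards [eventually_ge_atTop 2] with n hn F hF
    have : NeZero n := ⟨by omega⟩
    refine sum_matchProb_le d F _ fun y hy hyt ω hω => ?_
    exact ((hω.isom_ball hyt hn ℓ _ _ _).congr_left H).1 (hF hy)
  · filter_upwards [eventually_ge_atTop 2] with n hn F hF
    have : NeZero n := ⟨by omega⟩
    refine (sum_matchProb_le d F
      (fun ω => ¬ RootedGraph.Isom keepMult keepType keepWeight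
        ((incidenceGraph ℓ ω.1 ω.2).ball d) H) fun y hy hyt ω hω hI => ?_).trans (le_of_eq ?_)
    · exact hF hy (((hω.isom_ball hyt hn ℓ _ _ _).congr_left H).2 hI)
    · classical
      have hpos : (Nat.card ((Fin (m n) → Fin (k + 1) → ZMod n) × GVertex n (m n)) : ℝ) ≠ 0 := by
        exact_mod_cast Nat.card_pos.ne'
      rw [graphProb, eq_sub_iff_add_eq, ← add_div, div_eq_one_iff_eq hpos]
      simp only [Nat.card_eq_fintype_card]
      rw [add_comm, Fintype.card_subtype_compl, Nat.cast_sub (Fintype.card_subtype_le _)]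
      ring
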